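/- Let $k$ be a commutative domain in which $2$ is invertible, let $n\ge 1$, and let $\mathcal A=\{a_{ij}\mid 1\le i<j\le n\}\subset k$. Let $B=V_n(\mathcal A)$ be the $(-1)$-quantum Weyl algebra, the $k$-algebra generated by $x_1,\dots,x_n$ subject to $x_ix_j+x_jx_i=a_{ij}$ for $i<j$, and let $R=k[x_1^2,\dots,x_n^2]\subset B$, a central subalgebra. Conventions. A filtered algebra $T$ is a $k$-algebra with an exhaustive increasing multiplicative filtration $(F_mT)_{m\ge0}$ by $k$-submodules, $1\in F_0T$; $\operatorname{gr}T=\bigoplus_m F_mT/F_{m-1}T$ (with $F_{-1}T=0$) is connected graded if its degree-zero part is $k$ via the unit map; $\deg t$ is the least $m$ with $t\in F_mT$, for $t\neq0$. If an algebra $A$ is generated by $x_1,\dots,x_n$, which are $k$-linearly independent with $k\cap Y=0$ for $Y=\bigoplus_i kx_i$, then $A$ carries the standard filtration $F_mA=(k+Y)^m$. Suppose that $\operatorname{gr}A$ is a connected graded domain. A nonzero $f\in A$ is dominating if for every filtered algebra $T$ satisfying a polynomial identity with $\operatorname{gr}T$ a connected graded domain, and all $y_1,\dots,y_n\in T$ that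 are $k$-linearly independent in $T/F_0T$, there is a lift $P$ of $f$ to the free algebra $k\langle x_1,\dots,x_n\rangle$ such that either $P(y_1,\dots,y_n)=0$, or $\deg P(y_1,\dots,y_n)\ge\deg f$, with strict inequality if $\deg y_i>1$ for some $i$. An automorphism $g$ of the $k$-algebra $A$ is affine if $\deg g(x_i)=1$ for all $i$. If $A$ is finitely generated free of rank $w$ over a central subalgebra $R$, its regular trace $\operatorname{tr}:A\to R$ sends $b$ to the trace of left multiplication by $b$; the discriminant $d(A/R)$ is $\det(\operatorname{tr}(z_iz_j))_{w\times w}$ for an $R$-basis $z_1,\dots,z_w$, well defined up to a unit of $R$, and the discriminant ideal is generated by these determinants for all $z_1,\dots,z_w\in A$. The discriminant is called dominating if the discriminant ideal is principal, generated by a dominating element. The category $\mathbf{Af}$ consists of the $k$-flat algebras $A$ filtered as above by some $Y$, with $\operatorname{gr}A$ a connected graded domain, that are finitely generated free over their center and whose discriminant over the center is dominating. Finally, $f=c\,x_1^{b_1}\cdots x_n^{b_n}+(\mathrm{cwlt})$ means that $f-c\,x_1^{b_1}\cdots x_n^{b_n}$ is a $k$-linear combination of monomials $x_1^{e_1}\cdots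 x_n^{e_n}$ with $e_i\le b_i$ for all $i$ and $e_i<b_i$ for some $i$. Theorem. $B$, with $Y=\bigoplus_i kx_i$, has the following properties. 1. $B$ is finitely generated free over $R$ of rank $2^n$, and for every $R$-basis used to compute it, $d(B/R)=c\bigl(\prod_{i=1}^n x_i^2\bigr)^{2^{n-1}}+(\mathrm{cwlt})$ for some $c\in k^\times$. Moreover $\operatorname{gr}B$ is a connected graded domain, $d(B/R)$ is a dominating element of $B$, and the discriminant of $B$ over $R$ is dominating. 2. If $g$ is a $k$-algebra automorphism of $B$ such that $g(R)\subseteq R$ and $g^{-1}(R)\subseteq R$, then $g$ is affine. 3. If $n$ is even, then $B$ is in $\mathbf{Af}$. -/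

import Mathlib

open Polynomial

universe u v w

noncomputable section

namespace DiscAut

/-! ### Filtered algebras and the associated graded ring -/

/-- An increasing multiplicative `ℕ`-filtration of a `k`-algebra `T` by `k`-submodules. -/
structure AlgFiltration (k T : Type*) [CommRing k] [Ring T] [Algebra k T] where
  /-- the `m`-th piece of the filtration -/
  piece : ℕ → Submodule k T
  mono : Monotone piece
  one_mem : (1 : T) ∈ piece 0
  mul_mem : ∀ {i j : ℕ} {s t : T}, s ∈ piece i → t ∈ piece j → s * t ∈ piece (i + j)

namespace AlgFiltration

variable {k T : Type*} [CommRing k] [Ring T] [Algebra k T] (F : AlgFiltration k T)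

/-- `F_{m-1}`, with the convention `F_{-1} = 0`. -/
def prev : ℕ → Submodule k T
  | 0 => ⊥
  | m + 1 => F.piece m

theorem prev_le (m : ℕ) : F.prev m ≤ F.piece m := by
  cases m with
  | zero => exact bot_le
  | succ m => exact F.mono (Nat.le_succ m)

theorem mul_prev {i j : ℕ} {s t : T} (hs : s ∈ F.piece i) (ht : t ∈ F.prev j) :
    s * t ∈ F.prev (i + j) := by
  cases j with
  | zero =>
    have h : t = 0 := by simpa [prev] using ht
    simp [h]
  | succ j => exact F.mul_mem hs ht

theorem prev_mul {i j : ℕ} {s t : T} (hs : s ∈ F.prev i) (ht : t ∈ F.piece j) :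
    s * t ∈ F.prev (i + j) := by
  cases i with
  | zero =>
    have h : s = 0 := by simpa [prev] using hs
    simp [h]
  | succ i =>
    have h := F.mul_mem (i := i) hs ht
    rwa [Nat.add_right_comm]

/-- The graded ring `⨁ₘ Fₘ`, realised as the ring of the polynomials over `T` whose
coefficient in degree `m` lies in `Fₘ`. -/
def sumRing : Subring T[X] where
  carrier := {p | ∀ m, p.coeff m ∈ F.piece m}
  zero_mem' m := by simp
  one_mem' m := by
    rw [Polynomial.coeff_one]
    split_ifs with h
    · subst h; exact F.one_mem
    · exact zero_mem _
  add_mem' hp hq m := by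
    rw [Polynomial.coeff_add]; exact add_mem (hp m) (hq m)
  neg_mem' hp m := by
    rw [Polynomial.coeff_neg]; exact neg_mem (hp m)
  mul_mem' hp hq m := by
    rw [Polynomial.coeff_mul]
    refine sum_mem fun ij hij => ?_
    rw [← Finset.HasAntidiagonal.mem_antidiagonal.1 hij]
    exact F.mul_mem (hp _) (hq _)

/-- The ideal `⨁ₘ F_{m-1}` of `⨁ₘ Fₘ`. -/
def prevIdeal : Ideal F.sumRing where
  carrier := {p | ∀ m, (p : T[X]).coeff m ∈ F.prev m}
  zero_mem' m := by simp
  add_mem' hp hq m := by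
    rw [Subring.coe_add, Polynomial.coeff_add]; exact add_mem (hp m) (hq m)
  smul_mem' c p hp m := by
    rw [smul_eq_mul, Subring.coe_mul, Polynomial.coeff_mul]
    refine sum_mem fun ij hij => ?_
    rw [← Finset.HasAntidiagonal.mem_antidiagonal.1 hij]
    exact F.mul_prev (c.2 _) (hp _)

instance : F.prevIdeal.IsTwoSided where
  mul_mem_of_left {p} c hp := by
    intro m
    rw [Subring.coe_mul, Polynomial.coeff_mul]
    refine sum_mem fun ij hij => ?_
    rw [← Finset.HasAntidiagonal.mem_antidiagonal.1 hij]
    exact F.prev_mul (hp _) (c.2 _)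

/-- The associated graded ring `gr T = ⨁ₘ Fₘ / F_{m-1}`, as `(⨁ₘ Fₘ) / (⨁ₘ F_{m-1})`. -/
abbrev Gr := F.sumRing ⧸ F.prevIdeal

/-- The filtration is exhaustive. -/
def IsExhaustive : Prop := ∀ t : T, ∃ m, t ∈ F.piece m

/-- The degree-zero part `F₀ / F_{-1} = F₀` of the associated graded ring is `k`,
via the unit map. -/
def IsConnected : Prop :=
  Function.Injective (algebraMap k T) ∧ F.piece 0 = 1

/-- An exhaustive filtration whose associated graded ring is a connected graded domain. -/
structure IsConnectedDomain : Prop where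
  exhaustive : F.IsExhaustive
  connected : F.IsConnected
  isDomain : IsDomain F.Gr

/-- The degree of a nonzero element: the `m` with `t ∈ Fₘ` and `t ∉ F_{m-1}`
(only used for nonzero elements of exhaustively filtered algebras). -/
def deg (t : T) : ℕ := sInf {m | t ∈ F.piece m}

end AlgFiltration

/-- `T` satisfies a polynomial identity: some nonzero noncommutative polynomial over `k`
vanishes under every substitution of elements of `T` for its variables. -/
def IsPI (k T : Type*) [CommRing k] [Ring T] [Algebra k T] : Prop :=
  ∃ p : FreeAlgebra k ℕ, p ≠ 0 ∧ ∀ y : ℕ → T, FreeAlgebra.lift k y p = 0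

section Generated

variable {k A : Type*} [CommRing k] [Ring A] [Algebra k A] {n : ℕ}

/-- `Y = ∑ᵢ k xᵢ`. -/
def genSpan (k : Type*) {A : Type*} [CommRing k] [Ring A] [Algebra k A] {n : ℕ}
    (x : Fin n → A) : Submodule k A :=
  Submodule.span k (Set.range x)

/-- The standard filtration `Fₘ = (k + Y)ᵐ`, where `Y = ∑ᵢ k xᵢ`. -/
def stdFiltration (k : Type*) {A : Type*} [CommRing k] [Ring A] [Algebra k A] {n : ℕ}
    (x : Fin n → A) : AlgFiltration k A where
  piece m := (1 ⊔ genSpan k x) ^ m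
  mono := pow_right_monotone le_sup_left
  one_mem := by
    rw [pow_zero]; exact Submodule.one_le.1 le_rfl
  mul_mem hs ht := by
    rw [pow_add]; exact Submodule.mul_mem_mul hs ht

/-- `A` is a filtered algebra by means of `Y = ⨁ᵢ k xᵢ`: the `xᵢ` are a `k`-basis of `Y`,
`k ∩ Y = 0`, the standard filtration is exhaustive (that is, `Y` generates `A`), and `gr A` is a
connected graded domain. -/
structure IsFilteredDomain (k : Type*) {A : Type*} [CommRing k] [Ring A] [Algebra k A] {n : ℕ}
    (x : Fin n → A) : Prop where
  linearIndependent : LinearIndependent k x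
  disjoint : Disjoint (1 : Submodule k A) (genSpan k x)
  isConnectedDomain : (stdFiltration k x).IsConnectedDomain

/-- An algebra automorphism `g` is affine if `deg g(xᵢ) = 1` for all `i`. -/
def IsAffine (x : Fin n → A) (g : A ≃ₐ[k] A) : Prop :=
  ∀ i, (stdFiltration k x).deg (g (x i)) = 1

/-- The nonzero element `f` of the filtered algebra `A` is dominating, with respect to the
generators `xᵢ`: for all filtered PI algebras `T` with `gr T` a connected graded domain, and all
`yᵢ ∈ T` that are linearly independent in `T / F₀ T`, there is a lift `P` of `f` to the free
algebra such that either `P(y) = 0`, or `deg P(y) ≥ deg f`, strictly so if some `deg yᵢ > 1`. -/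
structure IsDominating {k : Type u} {A : Type w} [CommRing k] [Ring A] [Algebra k A]
    {n : ℕ} (x : Fin n → A) (f : A) : Prop where
  isFilteredDomain : IsFilteredDomain k x
  ne_zero : f ≠ 0
  dominates : ∀ (T : Type (max u v)) [Ring T] [Algebra k T] (F : AlgFiltration k T),
    IsPI k T → F.IsConnectedDomain →
    ∀ y : Fin n → T, LinearIndependent k (fun i => (F.piece 0).mkQ (y i)) →
    ∃ P : FreeAlgebra k (Fin n), FreeAlgebra.lift k x P = f ∧
      (FreeAlgebra.lift k y P = 0 ∨
        ((stdFiltration k x).deg f ≤ F.deg (FreeAlgebra.lift k y P) ∧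
          ((∃ i, 1 < F.deg (y i)) →
            (stdFiltration k x).deg f < F.deg (FreeAlgebra.lift k y P))))

/-- The ordered monomial `x₁^{b₁} ⋯ xₙ^{bₙ}`. -/
def monom (x : Fin n → A) (b : Fin n → ℕ) : A :=
  (List.ofFn fun i => x i ^ b i).prod

/-- The `k`-span of the monomials that are componentwise less than `x₁^{b₁} ⋯ xₙ^{bₙ}`,
that is, of the `x₁^{e₁} ⋯ xₙ^{eₙ}` with `eᵢ ≤ bᵢ` for all `i` and `eᵢ < bᵢ` for some `i`. -/
def cwlt (k : Type*) {A : Type*} [CommRing k] [Ring A] [Algebra k A] {n : ℕ}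
    (x : Fin n → A) (b : Fin n → ℕ) : Submodule k A :=
  Submodule.span k {m | ∃ e : Fin n → ℕ, (∀ i, e i ≤ b i) ∧ (∃ i, e i < b i) ∧ m = monom x e}

end Generated

/-! ### Discriminants over central subalgebras -/

section Discriminant

variable {k B : Type*} [CommRing k] [Ring B] [Algebra k B]

/-- A central subalgebra is a commutative ring. -/
abbrev centralCommRing (R : Subalgebra k B) (hR : R ≤ Subalgebra.center k B) : CommRing R :=
  { (inferInstance : Ring R) with
    mul_comm := fun r s =>
      Subtype.ext ((Subalgebra.mem_center_iff.1 (hR s.2)) (r : B)) }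

/-- An algebra is an algebra over each of its central subalgebras. -/
abbrev centralAlgebra (R : Subalgebra k B) (hR : R ≤ Subalgebra.center k B) :
    letI := centralCommRing R hR
    Algebra R B :=
  letI := centralCommRing R hR
  { (inferInstance : Module R B) with
    algebraMap := R.val.toRingHom
    commutes' := fun r b => (Subalgebra.mem_center_iff.1 (hR r.2) b).symm
    smul_def' := fun _ _ => rfl }

/-- The regular trace `B → R` (for `B` finitely generated free over the central subalgebra `R`):
the trace of the left multiplication. -/
def regularTrace (R : Subalgebra k B) (hR : R ≤ Subalgebra.center k B) (b : B) : R :=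
  letI := centralCommRing R hR
  letI := centralAlgebra R hR
  LinearMap.trace R B (Algebra.lmul R B b)

/-- The discriminant `det (tr (zᵢ zⱼ))` of a family `z₁, …, z_w`. -/
def disc (R : Subalgebra k B) (hR : R ≤ Subalgebra.center k B) {w : ℕ} (z : Fin w → B) : R :=
  letI := centralCommRing R hR
  Matrix.det (Matrix.of fun i j : Fin w => regularTrace R hR (z i * z j))

/-- The `w`-discriminant ideal. -/
def discIdeal (R : Subalgebra k B) (hR : R ≤ Subalgebra.center k B) (w : ℕ) : Ideal R :=
  Ideal.span (Set.range fun z : Fin w → B => disc R hR z)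

/-- The discriminant of `B` over `R` is dominating: the discriminant ideal is a principal ideal
generated by a dominating element. -/
def HasDominatingDisc {k : Type u} {B : Type w} [CommRing k] [Ring B] [Algebra k B]
    {n : ℕ} (x : Fin n → B) (R : Subalgebra k B) (hR : R ≤ Subalgebra.center k B) : Prop :=
  ∃ f : R, discIdeal R hR (Module.finrank R B) = Ideal.span {f} ∧
    IsDominating.{u, v, w} (k := k) x (f : B)

/-- The algebra `B`, filtered by means of `Y = ⨁ᵢ k xᵢ`, is an object of the category `Af`. -/
structure InAf (k : Type u) {B : Type w} [CommRing k] [Ring B] [Algebra k B]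
    {n : ℕ} (x : Fin n → B) : Prop where
  flat : Module.Flat k B
  isFilteredDomain : IsFilteredDomain k x
  finite : Module.Finite (Subalgebra.center k B) B
  free : Module.Free (Subalgebra.center k B) B
  dominating : HasDominatingDisc.{u, v, w} x (Subalgebra.center k B) le_rfl

end Discriminant

/-! ### The `(-1)`-quantum Weyl algebra -/

section QWeyl

variable {k : Type*} [CommRing k] {n : ℕ}

/-- The relations `xᵢ xⱼ + xⱼ xᵢ = aᵢⱼ` for `i < j`. -/
inductive QWeylRel (a : Fin n → Fin n → k) :
    FreeAlgebra k (Fin n) → FreeAlgebra k (Fin n) → Prop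
  | rel (i j : Fin n) (h : i < j) :
      QWeylRel a
        (FreeAlgebra.ι k i * FreeAlgebra.ι k j + FreeAlgebra.ι k j * FreeAlgebra.ι k i)
        (algebraMap k _ (a i j))

/-- The `(-1)`-quantum Weyl algebra `Vₙ(a)`; only the `aᵢⱼ` with `i < j` matter. -/
abbrev QWeyl (a : Fin n → Fin n → k) := RingQuot (QWeylRel a)

/-- The generators `xᵢ` of `Vₙ(a)`. -/
def qx (a : Fin n → Fin n → k) (i : Fin n) : QWeyl a :=
  RingQuot.mkAlgHom k (QWeylRel a) (FreeAlgebra.ι k i)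

theorem qx_rel (a : Fin n → Fin n → k) {i j : Fin n} (h : i < j) :
    qx a i * qx a j + qx a j * qx a i = algebraMap k _ (a i j) := by
  have := RingQuot.mkAlgHom_rel k (QWeylRel.rel (a := a) i j h)
  simpa [qx] using this

/-- The subalgebra `R = k[x₁², …, xₙ²]` of `Vₙ(a)`. -/
def sqSubalgebra (a : Fin n → Fin n → k) : Subalgebra k (QWeyl a) :=
  Algebra.adjoin k (Set.range fun i => qx a i ^ 2)

theorem qx_comm_sq (a : Fin n → Fin n → k) (i j : Fin n) :
    qx a i * qx a j ^ 2 = qx a j ^ 2 * qx a i := by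
  have key : ∀ c : k, qx a i * qx a j + qx a j * qx a i = algebraMap k _ c →
      qx a i * qx a j ^ 2 = qx a j ^ 2 * qx a i := by
    intro c hc
    have h1 : qx a i * qx a j = algebraMap k _ c - qx a j * qx a i := eq_sub_of_add_eq hc
    rw [pow_two, ← mul_assoc, h1, sub_mul, mul_assoc, h1, mul_sub, Algebra.commutes]
    noncomm_ring
  rcases lt_trichotomy i j with h | h | h
  · exact key _ (qx_rel a h)
  · subst h; rw [← pow_succ, ← pow_succ']
  · exact key (a j i) (by rw [add_comm]; exact qx_rel a h)

theorem sqSubalgebra_le_center (a : Fin n → Fin n → k) :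
    sqSubalgebra a ≤ Subalgebra.center k (QWeyl a) := by
  refine Algebra.adjoin_le ?_
  rintro _ ⟨j, rfl⟩
  rw [SetLike.mem_coe, Subalgebra.mem_center_iff]
  intro b
  obtain ⟨p, rfl⟩ := RingQuot.mkAlgHom_surjective k (QWeylRel a) b
  induction p using FreeAlgebra.induction with
  | grade0 r => rw [AlgHom.commutes]; exact Algebra.commutes _ _
  | grade1 i => exact qx_comm_sq a i j
  | mul p q hp hq =>
    rw [map_mul, mul_assoc, hq, ← mul_assoc, hp, mul_assoc]
  | add p q hp hq => rw [map_add, add_mul, mul_add, hp, hq]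

end QWeyl

end DiscAut

end

noncomputable section

namespace DiscAut

/-! ### Degrees in filtered algebras -/

namespace AlgFiltration

variable {k T : Type*} [CommRing k] [Ring T] [Algebra k T] (F : AlgFiltration k T)

/-! Since the squares `xⱼ²` are central, `B` behaves like a polynomial ring up to signs and lower
terms. Moving `xᵢ` into its place in `x^e` gives `± x^{e + δᵢ}` plus terms `± a_{ji} x^{e - δⱼ}` for
those `j < i` with `eⱼ` odd. These formulas define operators on the free module on exponents, and
the operators satisfy the defining relations (`op_relation`). A monomial sends the vacuum `[0]` to
its exponent `[e]`, so the ordered monomials, which span by rewriting, form a basis (`pbw`), and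
`x^e x^b = ± x^{e + b} + (cwlt)`. The rest uses only the facts packaged in `IsSkewPBW`: the standard
filtration is total degree, `gr B` is a domain, and `R` is the span of the monomials with all
exponents even.

Over `R` the squarefree monomials `x^U` form a basis. A trace lies in `R`, so an exponent in `tr
(x^U x^V)` is even and at most `1_U + 1_V`, hence at most `2 · 1_{U ∩ V}`. In the Leibniz expansion
of the discriminant only the identity permutation reaches the exponent `∑_U 2 · 1_U = (2ⁿ, …, 2ⁿ)`,
with coefficient a product of terms `± 2ⁿ`, a unit (`lead_disc`). Changing the basis multiplies by
the square of a unit of `R`, and such units are scalars.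

An element `c (∏ xᵢ²)^N + (cwlt)` is dominating: in a filtered algebra whose associated graded ring
is a domain, degrees add, so its value at `y` has degree exactly `2N ∑ deg yᵢ`
(`deg_smul_monom_add_cwlt`). The same count makes `g` affine: `g(d(B/R))` is the discriminant of the
basis transported by `g`, so `∑ deg g(xᵢ) ≤ n`, while every term is at least 1. For even `n` the
center is `R` (`center_eq`), which gives membership in `Af`. -/

theorem piece_le_prev {i j : ℕ} (h : i < j) : F.piece i ≤ F.prev j := by
  cases j with
  | zero => omega
  | succ j => exact F.mono (Nat.lt_succ_iff.1 h)

/-- The symbols of `s` and `t` are represented by the one-term polynomials `s Xⁱ` and `t Xʲ`; their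
product represents the symbol of `s * t`. -/
theorem mul_notMem_prev [IsDomain F.Gr] {i j : ℕ} {s t : T} (hs : s ∈ F.piece i)
    (hs' : s ∉ F.prev i) (ht : t ∈ F.piece j) (ht' : t ∉ F.prev j) : s * t ∉ F.prev (i + j) := by
  have key : ∀ {i : ℕ} {s : T}, s ∈ F.piece i → monomial i s ∈ F.sumRing := by
    intro i s hs m
    rw [coeff_monomial]
    split_ifs with h
    · exact h ▸ hs
    · exact zero_mem _
  have mem : ∀ {i : ℕ} {s : T} (hs : s ∈ F.piece i),
      (Ideal.Quotient.mk F.prevIdeal ⟨monomial i s, key hs⟩ = 0 ↔ s ∈ F.prev i) := by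
    intro i s hs
    rw [Ideal.Quotient.eq_zero_iff_mem]
    constructor
    · intro h
      simpa using h i
    · intro h m
      change (monomial i s).coeff m ∈ _
      rw [coeff_monomial]
      split_ifs with h'
      · exact h' ▸ h
      · exact zero_mem _
  intro h
  rw [← mem (F.mul_mem hs ht)] at h
  have e : (⟨monomial (i + j) (s * t), key (F.mul_mem hs ht)⟩ : F.sumRing) =
      ⟨monomial i s, key hs⟩ * ⟨monomial j t, key ht⟩ := by
    ext1
    exact (monomial_mul_monomial i j s t).symm
  rw [e, map_mul, mul_eq_zero, mem hs, mem ht] at h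
  tauto

/-- It is enough to test homogeneous elements: the product of the topmost nonzero components of two
elements of `gr T` is the component of their product in the sum of the two degrees. -/
theorem isDomain_gr [Nontrivial T]
    (h : ∀ {i j : ℕ} {s t : T}, s ∈ F.piece i → s ∉ F.prev i → t ∈ F.piece j → t ∉ F.prev j →
      s * t ∉ F.prev (i + j)) : IsDomain F.Gr := by
  classical
  have hnt : Nontrivial F.Gr := by
    refine ⟨⟨1, 0, ?_⟩⟩
    intro h1
    rw [← map_one (Ideal.Quotient.mk F.prevIdeal), Ideal.Quotient.eq_zero_iff_mem] at h1
    have := h1 0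
    simp [prev] at this
  have top : ∀ p : F.sumRing, p ∉ F.prevIdeal → ∃ i, (p : T[X]).coeff i ∉ F.prev i ∧
      ∀ j, i < j → (p : T[X]).coeff j ∈ F.prev j := by
    intro p hp
    obtain ⟨m, hm⟩ : ∃ m, (p : T[X]).coeff m ∉ F.prev m := by
      by_contra! hc
      exact hp hc
    let s := (p : T[X]).support.filter fun m => (p : T[X]).coeff m ∉ F.prev m
    have mem : ∀ m, m ∈ s ↔ (p : T[X]).coeff m ∉ F.prev m := by
      intro m
      simp only [s, Finset.mem_filter, mem_support_iff, ne_eq, and_iff_right_iff_imp]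
      intro h h0
      exact h (h0 ▸ zero_mem _)
    have hs : s.Nonempty := ⟨m, (mem m).2 hm⟩
    refine ⟨s.max' hs, (mem _).1 (s.max'_mem hs), fun j hj => ?_⟩
    by_contra hc
    exact absurd (s.le_max' j ((mem j).2 hc)) (not_le.2 hj)
  have hz : NoZeroDivisors F.Gr := by
    refine ⟨fun {x y} hxy => ?_⟩
    obtain ⟨p, rfl⟩ := Ideal.Quotient.mk_surjective x
    obtain ⟨q, rfl⟩ := Ideal.Quotient.mk_surjective y
    rw [← map_mul] at hxy
    simp only [Ideal.Quotient.eq_zero_iff_mem] at hxy ⊢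
    by_contra! hc
    obtain ⟨i, hi, hi'⟩ := top p hc.1
    obtain ⟨j, hj, hj'⟩ := top q hc.2
    refine h (p.2 i) hi (q.2 j) hj ?_
    have hm := hxy (i + j)
    rw [Subring.coe_mul, coeff_mul, ← Finset.add_sum_erase _ _
      (show (i, j) ∈ Finset.HasAntidiagonal.antidiagonal (i + j) by simp)] at hm
    -- Every other pair with `a + b = i + j` has `a > i` or `b > j`, so one of its factors vanishes
    -- in the graded ring.
    refine (Submodule.add_mem_iff_left _ (sum_mem fun ab hab => ?_)).1 hm
    obtain ⟨a, b⟩ := ab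
    simp only [Finset.mem_erase, ne_eq, Prod.mk.injEq, Finset.HasAntidiagonal.mem_antidiagonal] at hab
    rw [← hab.2]
    rcases lt_trichotomy a i with hlt | heq | hgt
    · exact F.mul_prev (p.2 a) (hj' b (by omega))
    · omega
    · exact F.prev_mul (hi' a hgt) (q.2 b)
  exact NoZeroDivisors.to_isDomain _

variable {F}

theorem deg_eq {m : ℕ} {t : T} (h : t ∈ F.piece m) (h' : t ∉ F.prev m) : F.deg t = m := by
  refine le_antisymm (Nat.sInf_le h) (le_csInf ⟨m, h⟩ fun j hj => ?_)
  by_contra! hc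
  exact h' (F.piece_le_prev hc hj)

theorem deg_le {m : ℕ} {t : T} (h : t ∈ F.piece m) : F.deg t ≤ m := Nat.sInf_le h

theorem IsExhaustive.mem_piece_deg (hF : F.IsExhaustive) (t : T) : t ∈ F.piece (F.deg t) :=
  Nat.sInf_mem (s := {m | t ∈ F.piece m}) (hF t)

theorem notMem_prev_deg {t : T} (ht : t ≠ 0) : t ∉ F.prev (F.deg t) := by
  intro h
  cases hd : F.deg t with
  | zero => rw [hd] at h; exact ht (by simpa [prev] using h)
  | succ m =>
    rw [hd] at h
    have := Nat.sInf_le (s := {m | t ∈ F.piece m}) h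
    unfold deg at hd
    omega

theorem pow_mem_piece {i : ℕ} {s : T} (hs : s ∈ F.piece i) (m : ℕ) :
    s ^ m ∈ F.piece (m * i) := by
  induction m with
  | zero => simpa using F.one_mem
  | succ m ih => rw [pow_succ, Nat.succ_mul]; exact F.mul_mem ih hs

theorem pow_notMem_prev [Nontrivial T] [IsDomain F.Gr] {i : ℕ} {s : T} (hs : s ∈ F.piece i)
    (hs' : s ∉ F.prev i) (m : ℕ) : s ^ m ∉ F.prev (m * i) := by
  induction m with
  | zero => simp [prev]
  | succ m ih =>
    rw [pow_succ, Nat.succ_mul]; exact F.mul_notMem_prev (pow_mem_piece hs m) ih hs hs'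

end AlgFiltration

/-! ### Degrees of ordered monomials and a criterion for domination -/

section Monomials

variable {k A : Type*} [CommRing k] [Ring A] [Algebra k A]

theorem monom_succ {n : ℕ} (x : Fin (n + 1) → A) (e : Fin (n + 1) → ℕ) :
    monom x e = x 0 ^ e 0 * monom (fun i => x i.succ) (fun i => e i.succ) := by
  simp [monom, List.ofFn_succ]

theorem map_monom {A' : Type*} [Ring A'] [Algebra k A'] {n : ℕ} (φ : A →ₐ[k] A') (x : Fin n → A)
    (e : Fin n → ℕ) : φ (monom x e) = monom (fun i => φ (x i)) e := by
  simp [monom, map_list_prod, List.map_ofFn, Function.comp_def]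

theorem map_cwlt {A' : Type*} [Ring A'] [Algebra k A'] {n : ℕ} (φ : A →ₐ[k] A') (x : Fin n → A)
    (b : Fin n → ℕ) : (cwlt k x b).map φ.toLinearMap = cwlt k (fun i => φ (x i)) b := by
  rw [cwlt, cwlt, Submodule.map_span]
  congr 1
  ext m
  constructor
  · rintro ⟨_, ⟨e, h1, h2, rfl⟩, rfl⟩
    exact ⟨e, h1, h2, map_monom φ x e⟩
  · rintro ⟨e, h1, h2, rfl⟩
    exact ⟨_, ⟨e, h1, h2, rfl⟩, map_monom φ x e⟩

variable {F : AlgFiltration k A} {n : ℕ} {y : Fin n → A} {d : Fin n → ℕ}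

theorem monom_mem_piece (hy : ∀ i, y i ∈ F.piece (d i)) (e : Fin n → ℕ) :
    monom y e ∈ F.piece (∑ i, e i * d i) := by
  induction n with
  | zero => simpa [monom] using F.one_mem
  | succ n ih =>
    rw [monom_succ, Fin.sum_univ_succ]
    exact F.mul_mem (AlgFiltration.pow_mem_piece (hy 0) _) (ih (fun i => hy i.succ) _)

theorem monom_notMem_prev [Nontrivial A] [IsDomain F.Gr] (hy : ∀ i, y i ∈ F.piece (d i))
    (hy' : ∀ i, y i ∉ F.prev (d i)) (e : Fin n → ℕ) :
    monom y e ∉ F.prev (∑ i, e i * d i) := by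
  induction n with
  | zero => simp [monom, AlgFiltration.prev]
  | succ n ih =>
    rw [monom_succ, Fin.sum_univ_succ]
    exact F.mul_notMem_prev (AlgFiltration.pow_mem_piece (hy 0) _)
      (AlgFiltration.pow_notMem_prev (hy 0) (hy' 0) _) (monom_mem_piece (fun i => hy i.succ) _)
      (ih (fun i => hy i.succ) (fun i => hy' i.succ) _)

theorem cwlt_le_prev (hy : ∀ i, y i ∈ F.piece (d i)) (hd : ∀ i, 0 < d i) (b : Fin n → ℕ) :
    cwlt k y b ≤ F.prev (∑ i, b i * d i) := by
  refine Submodule.span_le.2 ?_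
  rintro _ ⟨e, h1, ⟨i, h2⟩, rfl⟩
  refine F.piece_le_prev ?_ (monom_mem_piece hy e)
  exact Finset.sum_lt_sum (fun j _ => Nat.mul_le_mul_right _ (h1 j))
    ⟨i, Finset.mem_univ i, Nat.mul_lt_mul_of_pos_right h2 (hd i)⟩

/-- The degree of an element `c (∏ yᵢ²) ^ N + (cwlt)` of a filtered algebra. -/
theorem deg_smul_monom_add_cwlt [Nontrivial A] (hF : F.IsConnectedDomain)
    (hy : ∀ i, y i ∉ F.piece 0) {c : k} (hc : c ≠ 0) (N : ℕ) {v : A}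
    (hv : v ∈ cwlt k y fun _ => 2 * N) :
    F.deg (c • monom y (fun _ => 2) ^ N + v) = ∑ i, 2 * N * F.deg (y i) := by
  have := hF.isDomain
  have hmem : ∀ i, y i ∈ F.piece (F.deg (y i)) := fun i => hF.exhaustive.mem_piece_deg _
  have hnot : ∀ i, y i ∉ F.prev (F.deg (y i)) := fun i =>
    AlgFiltration.notMem_prev_deg fun h => hy i (h ▸ zero_mem _)
  have hpos : ∀ i, 0 < F.deg (y i) := fun i => by
    by_contra! h
    exact hy i (F.mono h (hmem i))
  -- The summand `0` is the degree of the scalar `c`, a nonzero element of `F₀ = k`.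
  have hs : ∑ i, 2 * N * F.deg (y i) = 0 + N * ∑ i, 2 * F.deg (y i) := by
    rw [zero_add, Finset.mul_sum]
    exact Finset.sum_congr rfl fun i _ => by ring
  have hv' := cwlt_le_prev (F := F) hmem hpos _ hv
  have h1 := monom_mem_piece hmem (fun _ => 2)
  have h2 := monom_notMem_prev hmem hnot (fun _ => 2)
  have hc1 : algebraMap k A c ∈ F.piece 0 := by
    rw [hF.connected.2]; exact Submodule.algebraMap_mem c
  have hc2 : algebraMap k A c ∉ F.prev 0 := by
    simpa [AlgFiltration.prev] using
      (map_ne_zero_iff _ hF.connected.1).2 hc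
  refine AlgFiltration.deg_eq (Submodule.add_mem _ ?_ (F.prev_le _ hv')) fun h => ?_
  · rw [hs, Algebra.smul_def]
    exact F.mul_mem hc1 (AlgFiltration.pow_mem_piece h1 N)
  · rw [Submodule.add_mem_iff_left _ hv', hs, Algebra.smul_def] at h
    exact F.mul_notMem_prev hc1 hc2 (AlgFiltration.pow_mem_piece h1 N)
      (AlgFiltration.pow_notMem_prev h1 h2 N) h

/-- Only this upper bound is needed on the side of `A`; it compares with the exact degree computed
at the `yᵢ`. -/
theorem deg_stdFiltration_le {n : ℕ} (x : Fin n → A) (c : k) (N : ℕ) {v : A}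
    (hv : v ∈ cwlt k x fun _ => 2 * N) :
    (stdFiltration k x).deg (c • monom x (fun _ => 2) ^ N + v) ≤ ∑ _i : Fin n, 2 * N := by
  have hx : ∀ i, x i ∈ (stdFiltration k x).piece 1 := fun i => by
    change x i ∈ (1 ⊔ genSpan k x) ^ 1
    rw [pow_one]
    exact Submodule.mem_sup_right (Submodule.subset_span ⟨i, rfl⟩)
  refine AlgFiltration.deg_le (Submodule.add_mem _ (Submodule.smul_mem _ _ ?_) ?_)
  · have := AlgFiltration.pow_mem_piece (monom_mem_piece hx (fun _ => 2)) N
    convert this using 2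
    rw [Finset.mul_sum]
    exact Finset.sum_congr rfl fun i _ => by ring
  · have := (stdFiltration k x).prev_le _ (cwlt_le_prev hx (fun _ => one_pos) _ hv)
    simpa using this

/-- An element `c (∏ xᵢ²) ^ N + (cwlt)` with `c ≠ 0` and `N > 0` is dominating. -/
theorem isDominating_of_sub_mem_cwlt {k : Type u} {A : Type w} [CommRing k] [Ring A]
    [Algebra k A] [Nontrivial A] {n : ℕ} {x : Fin n → A} (hx : IsFilteredDomain k x) {f : A}
    (hf : f ≠ 0) {c : k} (hc : c ≠ 0) {N : ℕ} (hN : 0 < N)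
    (h : f - c • monom x (fun _ => 2) ^ N ∈ cwlt k x fun _ => 2 * N) :
    IsDominating.{u, v, w} (k := k) x f := by
  refine ⟨hx, hf, fun T _ _ F _ hF y hy => ?_⟩
  have hk : Nontrivial k := ⟨⟨c, 0, hc⟩⟩
  have hT : Nontrivial T := hF.connected.1.nontrivial
  have hx' : x = fun i => FreeAlgebra.lift k x (FreeAlgebra.ι k i) := by
    funext i; simp
  -- The lower terms are lifted monomial by monomial, so that substituting `y` again produces only
  -- componentwise lower monomials.
  obtain ⟨v, hv, hv'⟩ : f - c • monom x (fun _ => 2) ^ N ∈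
      (cwlt k (FreeAlgebra.ι k) fun _ => 2 * N).map (FreeAlgebra.lift k x).toLinearMap := by
    rw [map_cwlt, ← hx']; exact h
  refine ⟨c • monom (FreeAlgebra.ι k) (fun _ => 2) ^ N + v, ?_, Or.inr ?_⟩
  · change FreeAlgebra.lift k x v = _ at hv'
    rw [map_add, hv', map_smul, map_pow, map_monom, ← hx', add_sub_cancel]
  · have hv2 : FreeAlgebra.lift k y v ∈ cwlt k y fun _ => 2 * N := by
      have := Submodule.mem_map_of_mem (f := (FreeAlgebra.lift k y).toLinearMap) hv
      rw [map_cwlt] at this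
      simpa using this
    have hy0 : ∀ i, y i ∉ F.piece 0 := fun i hi =>
      hy.ne_zero i ((Submodule.Quotient.mk_eq_zero _).2 hi)
    have hpos : ∀ i, 1 ≤ F.deg (y i) := fun i => by
      by_contra! h
      exact hy0 i (F.mono (by omega) (hF.exhaustive.mem_piece_deg (y i)))
    have e : FreeAlgebra.lift k y (c • monom (FreeAlgebra.ι k) (fun _ => 2) ^ N + v) =
        c • monom y (fun _ => 2) ^ N + FreeAlgebra.lift k y v := by
      rw [map_add, map_smul, map_pow, map_monom]
      simp
    rw [e, deg_smul_monom_add_cwlt hF hy0 hc N hv2]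
    have hle := deg_stdFiltration_le x c N h
    rw [add_sub_cancel] at hle
    refine ⟨hle.trans (Finset.sum_le_sum fun i _ => Nat.le_mul_of_pos_right _ (hpos i)), ?_⟩
    rintro ⟨i, hi⟩
    refine hle.trans_lt (Finset.sum_lt_sum
      (fun i _ => Nat.le_mul_of_pos_right _ (hpos i)) ⟨i, Finset.mem_univ i, ?_⟩)
    exact (Nat.lt_mul_iff_one_lt_right (by omega)).2 hi

end Monomials

/-! ### Creation and annihilation operators -/

section Operators

variable (k : Type*) [CommRing k] {n : ℕ}

/-- The sign of moving `xᵢ` past `x₁^{e₁} ⋯ x_{i-1}^{e_{i-1}}`. -/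
def sgn (i : Fin n) (e : Fin n → ℕ) : k := (-1) ^ ∑ j ∈ Finset.Iio i, e j

theorem sgn_mul_self (i : Fin n) (e : Fin n → ℕ) : sgn k i e * sgn k i e = 1 := by
  rw [sgn, ← mul_pow]; simp

theorem sgn_add_single (i j : Fin n) (e : Fin n → ℕ) :
    sgn k i (e + Pi.single j 1) = if j < i then -sgn k i e else sgn k i e := by
  simp only [sgn, Pi.add_apply, Finset.sum_add_distrib]
  split_ifs with h <;> simp [h, pow_succ]

theorem sgn_zero (i : Fin n) (e : Fin n → ℕ) (h : ∀ j < i, e j = 0) : sgn k i e = 1 := by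
  rw [sgn, Finset.sum_eq_zero fun j hj => h j (Finset.mem_Iio.1 hj), pow_zero]

/-- `[e] ↦ ± [e + δᵢ]`. -/
def raise (i : Fin n) : ((Fin n → ℕ) →₀ k) →ₗ[k] ((Fin n → ℕ) →₀ k) :=
  Finsupp.linearCombination k fun e => Finsupp.single (e + Pi.single i 1) (sgn k i e)

open Classical in
/-- `[e] ↦ ± [e - δᵢ]` for odd `eᵢ`, and `[e] ↦ 0` for even `eᵢ`. -/
def lower (i : Fin n) : ((Fin n → ℕ) →₀ k) →ₗ[k] ((Fin n → ℕ) →₀ k) :=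
  Finsupp.linearCombination k fun e =>
    if Even (e i) then 0 else Finsupp.single (e - Pi.single i 1) (sgn k i e)

theorem raise_single (i : Fin n) (e : Fin n → ℕ) (c : k) :
    raise k i (Finsupp.single e c) = Finsupp.single (e + Pi.single i 1) (sgn k i e * c) := by
  simp [raise, Finsupp.linearCombination_single, mul_comm]

theorem lower_single_of_even {i : Fin n} {e : Fin n → ℕ} (h : Even (e i)) (c : k) :
    lower k i (Finsupp.single e c) = 0 := by
  simp [lower, Finsupp.linearCombination_single, h]

theorem lower_single_add {i : Fin n} {e : Fin n → ℕ} (h : Even (e i)) (c : k) :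
    lower k i (Finsupp.single (e + Pi.single i 1) c) = Finsupp.single e (sgn k i e * c) := by
  have h' : ¬ Even ((e + Pi.single i 1 : Fin n → ℕ) i) := by
    simpa [Nat.even_add_one] using h
  rw [lower, Finsupp.linearCombination_single, if_neg h', sgn_add_single, if_neg (lt_irrefl i),
    add_tsub_cancel_right, Finsupp.smul_single, smul_eq_mul, mul_comm]

theorem exists_eq_add_single {i : Fin n} {e : Fin n → ℕ} (h : ¬ Even (e i)) :
    ∃ e' : Fin n → ℕ, Even (e' i) ∧ e = e' + Pi.single i 1 := by
  have h1 : Pi.single i 1 ≤ e := by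
    intro j
    by_cases hj : j = i
    · subst hj
      rw [Pi.single_eq_same]
      exact Nat.one_le_iff_ne_zero.2 fun h0 => h (by simp [h0])
    · simp [Pi.single_eq_of_ne hj]
  refine ⟨e - Pi.single i 1, ?_, (tsub_add_cancel_of_le h1).symm⟩
  rw [Nat.not_even_iff_odd] at h
  simpa using Nat.Odd.sub_odd h odd_one

theorem raise_raise {i j : Fin n} (h : i ≠ j) :
    raise k i * raise k j + raise k j * raise k i = 0 := by
  refine Finsupp.lhom_ext fun e c => ?_
  simp only [LinearMap.add_apply, Module.End.mul_apply, raise_single, sgn_add_single,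
    LinearMap.zero_apply]
  rw [add_right_comm e, ← Finsupp.single_add]
  rcases lt_or_gt_of_ne h with h | h
  · simp only [if_pos h, if_neg h.not_gt]; exact Finsupp.single_eq_zero.2 (by ring)
  · simp only [if_pos h, if_neg h.not_gt]; exact Finsupp.single_eq_zero.2 (by ring)

/-- Exactly one of the two summands survives, according to the parity of `eᵢ`. With the other
anticommutators, this says that the `raise` and `lower` operators obey Clifford-type relations,
except that `raise k i` need not square to zero. -/
theorem lower_raise_self (i : Fin n) : lower k i * raise k i + raise k i * lower k i = 1 := by
  refine Finsupp.lhom_ext fun e c => ?_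
  simp only [LinearMap.add_apply, Module.End.mul_apply, raise_single, Module.End.one_apply]
  by_cases he : Even (e i)
  · rw [lower_single_of_even k he, lower_single_add k he, map_zero, add_zero, ← mul_assoc,
      sgn_mul_self, one_mul]
  · obtain ⟨e, he', rfl⟩ := exists_eq_add_single he
    rw [lower_single_add k he', raise_single, lower_single_of_even, zero_add, ← mul_assoc,
      sgn_mul_self, one_mul]
    rw [Nat.not_even_iff_odd] at he
    simpa using he.add_odd odd_one

theorem lower_raise {i j : Fin n} (h : i ≠ j) :
    lower k i * raise k j + raise k j * lower k i = 0 := by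
  refine Finsupp.lhom_ext fun e c => ?_
  simp only [LinearMap.add_apply, Module.End.mul_apply, raise_single, LinearMap.zero_apply]
  by_cases he : Even (e i)
  · rw [lower_single_of_even k he, lower_single_of_even, map_zero, add_zero]
    simpa [Pi.single_eq_of_ne h] using he
  · obtain ⟨e, he', rfl⟩ := exists_eq_add_single he
    rw [lower_single_add k he', raise_single, add_right_comm, lower_single_add, ←
      Finsupp.single_add, sgn_add_single, sgn_add_single]
    · rcases lt_or_gt_of_ne h with h | h
      · simp only [if_pos h, if_neg h.not_gt]; exact Finsupp.single_eq_zero.2 (by ring)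
      · simp only [if_pos h, if_neg h.not_gt]; exact Finsupp.single_eq_zero.2 (by ring)
    · simpa [Pi.single_eq_of_ne h] using he'

theorem lower_lower (i j : Fin n) : lower k i * lower k j + lower k j * lower k i = 0 := by
  refine Finsupp.lhom_ext fun e c => ?_
  simp only [LinearMap.add_apply, Module.End.mul_apply, LinearMap.zero_apply]
  rcases eq_or_ne i j with rfl | h
  · by_cases he : Even (e i)
    · simp [lower_single_of_even k he]
    · obtain ⟨e, he', rfl⟩ := exists_eq_add_single he
      rw [lower_single_add k he', lower_single_of_even k he', add_zero]
  by_cases hi : Even (e i)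
  · rw [lower_single_of_even k hi, map_zero, add_zero]
    by_cases hj : Even (e j)
    · simp [lower_single_of_even k hj]
    · obtain ⟨e, hj', rfl⟩ := exists_eq_add_single hj
      rw [lower_single_add k hj', lower_single_of_even]
      simpa [Pi.single_eq_of_ne h] using hi
  · obtain ⟨e, hi', rfl⟩ := exists_eq_add_single hi
    rw [lower_single_add k hi']
    by_cases hj : Even (e j)
    · rw [lower_single_of_even k hj, lower_single_of_even, map_zero, add_zero]
      simpa [Pi.single_eq_of_ne h.symm] using hj
    · obtain ⟨e, hj', rfl⟩ := exists_eq_add_single hj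
      have hi'' : Even (e i) := by simpa [Pi.single_eq_of_ne h] using hi'
      rw [lower_single_add k hj', add_right_comm, lower_single_add, lower_single_add k hi'',
        ← Finsupp.single_add, sgn_add_single, sgn_add_single]
      · rcases lt_or_gt_of_ne h with h | h
        · simp only [if_pos h, if_neg h.not_gt]; exact Finsupp.single_eq_zero.2 (by ring)
        · simp only [if_pos h, if_neg h.not_gt]; exact Finsupp.single_eq_zero.2 (by ring)
      · simpa [Pi.single_eq_of_ne h.symm] using hj'

variable {k}

/-- The left multiplication by `xᵢ`, in terms of the monomials `[e] = x₁^{e₁} ⋯ xₙ^{eₙ}`. -/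
def op (a : Fin n → Fin n → k) (i : Fin n) : Module.End k ((Fin n → ℕ) →₀ k) :=
  raise k i + ∑ j ∈ Finset.Iio i, a j i • lower k j

/-- Everything anticommutes except `lower k l` with `raise k l`. For `i < j`, the operator `lower k
i` occurs in `op a j` with coefficient `a i j`, whereas `lower k j` does not occur in `op a i`; a
single mixed term therefore survives. -/
theorem op_relation (a : Fin n → Fin n → k) {i j : Fin n} (h : i < j) :
    op a i * op a j + op a j * op a i = algebraMap k _ (a i j) := by
  have expand : ∀ P Q P' Q' : Module.End k ((Fin n → ℕ) →₀ k),
      (P + Q) * (P' + Q') + (P' + Q') * (P + Q) =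
        (P * P' + P' * P) + (P * Q' + Q' * P) + (Q * P' + P' * Q) + (Q * Q' + Q' * Q) := by
    intros; noncomm_ring
  have raise_sum : ∀ (m : Fin n) (s : Finset (Fin n)) (c : Fin n → k),
      raise k m * (∑ l ∈ s, c l • lower k l) + (∑ l ∈ s, c l • lower k l) * raise k m =
        if m ∈ s then c m • 1 else 0 := by
    intro m s c
    rw [Finset.mul_sum, Finset.sum_mul, ← Finset.sum_add_distrib]
    rw [← Finset.sum_ite_eq s m fun l => c l • (1 : Module.End k ((Fin n → ℕ) →₀ k))]
    refine Finset.sum_congr rfl fun l _ => ?_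
    rw [mul_smul_comm, smul_mul_assoc, ← smul_add, add_comm]
    split_ifs with hl
    · rw [hl, lower_raise_self]
    · rw [lower_raise k (Ne.symm hl), smul_zero]
  rw [op, op, expand, raise_raise k h.ne, raise_sum, add_comm (_ * raise k j), raise_sum,
    if_pos (Finset.mem_Iio.2 h), if_neg (by simpa using h.le), Algebra.algebraMap_eq_smul_one]
  suffices hs : ∀ s t : Finset (Fin n), ∀ c d : Fin n → k,
      (∑ l ∈ s, c l • lower k l) * (∑ l ∈ t, d l • lower k l) +
        (∑ l ∈ t, d l • lower k l) * (∑ l ∈ s, c l • lower k l) = 0 by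
    rw [hs]; simp
  intro s t c d
  rw [Finset.sum_mul_sum, Finset.sum_mul_sum, Finset.sum_comm (s := t), ← Finset.sum_add_distrib]
  refine Finset.sum_eq_zero fun l _ => ?_
  rw [← Finset.sum_add_distrib]
  refine Finset.sum_eq_zero fun m _ => ?_
  rw [smul_mul_smul_comm, smul_mul_smul_comm, mul_comm (d m), ← smul_add, lower_lower, smul_zero]

/-! ### Leading terms -/

/-- The exponents of `v` are componentwise at most `b`, and `c` is the coefficient of `[b]`. -/
structure Lead (v : (Fin n → ℕ) →₀ k) (b : Fin n → ℕ) (c : k) : Prop where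
  coeff : v b = c
  le : ∀ e, v e ≠ 0 → e ≤ b

namespace Lead

variable {v v' : (Fin n → ℕ) →₀ k} {b b' : Fin n → ℕ} {c c' : k}

theorem single (b : Fin n → ℕ) (c : k) : Lead (Finsupp.single b c) b c := by
  classical
  refine ⟨by simp, fun e he => ?_⟩
  rw [Finsupp.single_apply] at he
  split_ifs at he with h
  · exact h.ge
  · exact absurd rfl he

theorem zero (b : Fin n → ℕ) : Lead (0 : (Fin n → ℕ) →₀ k) b 0 := ⟨rfl, fun _ h => absurd rfl h⟩

theorem add (h : Lead v b c) (h' : Lead v' b c') : Lead (v + v') b (c + c') := by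
  refine ⟨by simp [h.coeff, h'.coeff], fun e he => ?_⟩
  by_contra hc
  refine he ?_
  rw [Finsupp.add_apply, not_imp_comm.1 (h.le e) hc, not_imp_comm.1 (h'.le e) hc, add_zero]

theorem smul (h : Lead v b c) (r : k) : Lead (r • v) b (r * c) :=
  ⟨by simp [h.coeff], fun e he => h.le e fun h0 => he (by simp [h0])⟩

theorem sum {ι : Type*} (s : Finset ι) {f : ι → (Fin n → ℕ) →₀ k} {g : ι → k}
    (h : ∀ i ∈ s, Lead (f i) b (g i)) : Lead (∑ i ∈ s, f i) b (∑ i ∈ s, g i) := by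
  classical
  induction s using Finset.induction_on with
  | empty => simpa using zero b
  | insert i s hi ih =>
    rw [Finset.sum_insert hi, Finset.sum_insert hi]
    exact (h i (Finset.mem_insert_self i s)).add (ih fun j hj => h j (Finset.mem_insert_of_mem hj))

/-- A leading coefficient is allowed to be zero, so terms strictly below `b'` can be added to a
leading term at `b'` without changing it. -/
theorem of_lt (h : Lead v b c) (hb : b < b') : Lead v b' 0 := by
  refine ⟨?_, fun e he => (h.le e he).trans hb.le⟩
  by_contra h0
  exact absurd (h.le b' h0) (not_le_of_gt hb)

theorem iff_sub_mem_supported :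
    Lead v b c ↔ v - Finsupp.single b c ∈ Finsupp.supported k k (Set.Iio b) := by
  classical
  rw [Finsupp.mem_supported']
  constructor
  · intro h e he
    rw [Set.mem_Iio] at he
    rw [Finsupp.sub_apply, Finsupp.single_apply]
    split_ifs with hb
    · rw [← hb, h.coeff, sub_self]
    · rw [sub_zero]
      by_contra h0
      exact he (lt_of_le_of_ne (h.le e h0) (Ne.symm hb))
  · intro h
    have h1 : v b = c := by simpa [sub_eq_zero] using h b (lt_irrefl b)
    refine ⟨h1, fun e he => ?_⟩
    by_contra hle
    have hb : b ≠ e := fun hb => hle hb.ge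
    have := h e fun hlt => hle (le_of_lt hlt)
    rw [Finsupp.sub_apply, Finsupp.single_apply, if_neg hb, sub_zero] at this
    exact he this

theorem sum_single (h : Lead v b c) : v = ∑ e ∈ Finset.Iic b, Finsupp.single e (v e) := by
  conv_lhs => rw [← Finsupp.sum_single v]
  refine Finsupp.sum_of_support_subset _ (fun e he => ?_) _ (by simp)
  exact Finset.mem_Iic.2 (h.le e (Finsupp.mem_support_iff.1 he))

/-- A linear map that sends `[e]` to `ε(e) [e + d] + (cwlt)` multiplies leading coefficients
by `ε`. -/
theorem map {d : Fin n → ℕ} {ε : (Fin n → ℕ) → k}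
    {f : ((Fin n → ℕ) →₀ k) →ₗ[k] ((Fin n → ℕ) →₀ k)}
    (hf : ∀ e c, Lead (f (Finsupp.single e c)) (e + d) (ε e * c)) (h : Lead v b c) :
    Lead (f v) (b + d) (ε b * c) := by
  classical
  have key := sum (b := b + d) (Finset.Iic b) (f := fun e => f (Finsupp.single e (v e)))
    (g := fun e => if e = b then ε b * c else 0) ?_
  · rw [h.sum_single, map_sum]
    simpa using key
  · intro e he
    split_ifs with heb
    · subst heb
      rw [h.coeff]
      exact hf _ _
    · exact (hf e (v e)).of_lt (add_lt_add_left (lt_of_le_of_ne (Finset.mem_Iic.1 he) heb) d)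

end Lead

variable (a : Fin n → Fin n → k)

theorem op_single (i : Fin n) (e : Fin n → ℕ) (c : k) :
    Lead (op a i (Finsupp.single e c)) (e + Pi.single i 1) (sgn k i e * c) := by
  rw [op, LinearMap.add_apply, raise_single, LinearMap.sum_apply]
  have h0 : Lead (∑ j ∈ Finset.Iio i, (a j i • lower k j) (Finsupp.single e c))
      (e + Pi.single i 1) (∑ j ∈ Finset.Iio i, 0) := by
    refine Lead.sum _ fun j _ => ?_
    rw [LinearMap.smul_apply]
    suffices h : Lead (lower k j (Finsupp.single e c)) (e + Pi.single i 1) 0 by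
      simpa using h.smul (a j i)
    by_cases he : Even (e j)
    · rw [lower_single_of_even k he]; exact Lead.zero _
    · obtain ⟨e, he', rfl⟩ := exists_eq_add_single he
      rw [lower_single_add k he']
      refine (Lead.single _ _).of_lt ?_
      rw [add_assoc]
      refine lt_add_of_pos_right _ ?_
      refine lt_of_lt_of_le ?_ (le_add_of_nonneg_right fun _ => Nat.zero_le _)
      exact Pi.single_pos.2 one_pos
  have h1 := (Lead.single (e + Pi.single i 1) (sgn k i e * c)).add h0
  rwa [Finset.sum_const_zero, add_zero] at h1

/-- There is nothing to move past: the sign is trivial and each `lower k j` with `j < i` kills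
`[e]`. This makes the action of ordered monomials on the vacuum exact, without lower terms. -/
theorem op_single_of_zero {i : Fin n} {e : Fin n → ℕ} (h : ∀ j < i, e j = 0) (c : k) :
    op a i (Finsupp.single e c) = Finsupp.single (e + Pi.single i 1) c := by
  rw [op, LinearMap.add_apply, raise_single, LinearMap.sum_apply, sgn_zero k i e h, one_mul,
    Finset.sum_eq_zero, add_zero]
  intro j hj
  rw [LinearMap.smul_apply, lower_single_of_even, smul_zero]
  simp [h j (Finset.mem_Iio.1 hj)]

variable {a}

theorem op_pow_single (i : Fin n) (m : ℕ) (e : Fin n → ℕ) (c : k) :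
    Lead ((op a i ^ m) (Finsupp.single e c)) (e + Pi.single i m) (sgn k i e ^ m * c) := by
  induction m with
  | zero => simpa using Lead.single e c
  | succ m ih =>
    rw [pow_succ', Module.End.mul_apply]
    have := ih.map (op_single a i)
    have hs : ∀ m, sgn k i (e + Pi.single i m) = sgn k i e := by
      intro m
      rw [sgn, sgn]
      congr 1
      refine Finset.sum_congr rfl fun j hj => ?_
      simp [Pi.single_eq_of_ne (Finset.mem_Iio.1 hj).ne]
    rw [hs, add_assoc, ← Pi.single_add, ← mul_assoc, ← pow_succ'] at this
    exact this

theorem op_pow_single_of_zero {i : Fin n} (m : ℕ) {e : Fin n → ℕ} (h : ∀ j < i, e j = 0) (c : k) :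
    (op a i ^ m) (Finsupp.single e c) = Finsupp.single (e + Pi.single i m) c := by
  induction m with
  | zero => simp
  | succ m ih =>
    rw [pow_succ', Module.End.mul_apply, ih, op_single_of_zero, add_assoc, ← Pi.single_add]
    intro j hj
    simp [h j hj, Pi.single_eq_of_ne hj.ne]

theorem list_sum_single_apply_of_notMem (L : List (Fin n)) (e : Fin n → ℕ) {j : Fin n}
    (h : j ∉ L) : (L.map fun i => (Pi.single i (e i) : Fin n → ℕ)).sum j = 0 := by
  induction L with
  | nil => rfl
  | cons i L ih =>
    rw [List.mem_cons, not_or] at h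
    simp [ih h.2, Pi.single_eq_of_ne h.1]

/-- In an increasing list the factors acting before `op a i` change only exponents at indices above
`i`, while the sign of `op a i` reads only those below `i`; so all signs can be evaluated at the
initial `b`. -/
theorem list_prod_op_single {L : List (Fin n)} (hL : L.Pairwise (· < ·)) (e b : Fin n → ℕ)
    (c : k) : Lead ((L.map fun i => op a i ^ e i).prod (Finsupp.single b c))
      (b + (L.map fun i => Pi.single i (e i)).sum)
      ((L.map fun i => sgn k i b ^ e i).prod * c) := by
  induction L with
  | nil => simpa using Lead.single b c
  | cons i L ih =>
    rw [List.pairwise_cons] at hL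
    have h := (ih hL.2).map (op_pow_single (a := a) i (e i))
    have hs : sgn k i (b + (L.map fun i => (Pi.single i (e i) : Fin n → ℕ)).sum) = sgn k i b := by
      rw [sgn, sgn]
      congr 1
      refine Finset.sum_congr rfl fun j hj => ?_
      rw [Pi.add_apply, list_sum_single_apply_of_notMem, add_zero]
      exact fun hjL => lt_asymm (hL.1 j hjL) (Finset.mem_Iio.1 hj)
    rw [hs, add_assoc, add_comm (List.sum _), ← mul_assoc] at h
    simpa using h

theorem list_prod_op_single_zero {L : List (Fin n)} (hL : L.Pairwise (· < ·)) (e : Fin n → ℕ) :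
    (L.map fun i => op a i ^ e i).prod (Finsupp.single 0 1) =
      Finsupp.single (L.map fun i => Pi.single i (e i)).sum 1 := by
  induction L with
  | nil => simp
  | cons i L ih =>
    rw [List.pairwise_cons] at hL
    rw [List.map_cons, List.prod_cons, Module.End.mul_apply, ih hL.2, op_pow_single_of_zero,
      List.map_cons, List.sum_cons, add_comm]
    intro j hj
    exact list_sum_single_apply_of_notMem _ _ fun hjL => lt_asymm (hL.1 j hjL) hj

end Operators

/-! ### The monomial basis of the quantum Weyl algebra -/

/-- As `y²` commutes with `x`, only the parity of `m` matters, and one odd factor `y` is exchanged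
by the relation. -/
theorem mul_pow_of_anticommute {k A : Type*} [CommRing k] [Ring A] [Algebra k A] {x y : A}
    (hsq : x * y ^ 2 = y ^ 2 * x) (h : x * y = y * x ∨ ∃ c : k, x * y + y * x = algebraMap k A c)
    (m : ℕ) : ∃ (c d : k) (m' : ℕ), x * y ^ m = c • (y ^ m * x) + d • y ^ m' := by
  rcases h with h | ⟨c, hc⟩
  · refine ⟨1, 0, 0, ?_⟩
    rw [one_smul, zero_smul, add_zero]
    exact Commute.pow_right h m
  have hsq' : ∀ l, x * (y ^ 2) ^ l = (y ^ 2) ^ l * x := fun l =>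
    Commute.pow_right (hsq : Commute _ _) l
  obtain ⟨l, rfl | rfl⟩ := Nat.even_or_odd' m
  · exact ⟨1, 0, 0, by rw [pow_mul, hsq']; simp⟩
  · refine ⟨-1, c, 2 * l, ?_⟩
    rw [pow_succ, ← mul_assoc, pow_mul, hsq', mul_assoc, eq_sub_of_add_eq hc, mul_sub,
      ← Algebra.commutes, ← Algebra.smul_def, neg_smul, one_smul, mul_assoc, sub_eq_neg_add]

section PBW

variable {k : Type*} [CommRing k] {n : ℕ} (a : Fin n → Fin n → k)

/-- The action of `Vₙ(a)` on the free module on the monomials. -/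
def rho : QWeyl a →ₐ[k] Module.End k ((Fin n → ℕ) →₀ k) :=
  RingQuot.liftAlgHom k ⟨FreeAlgebra.lift k (op a), by
    rintro _ _ ⟨i, j, h⟩
    simpa using op_relation a h⟩

theorem rho_qx (i : Fin n) : rho a (qx a i) = op a i := by
  simp [rho, qx]

theorem monom_eq_list_prod (e : Fin n → ℕ) :
    monom (qx a) e = ((List.finRange n).map fun i => qx a i ^ e i).prod := by
  rw [monom, List.ofFn_eq_map]

theorem rho_monom (e : Fin n → ℕ) :
    rho a (monom (qx a) e) = ((List.finRange n).map fun i => op a i ^ e i).prod := by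
  rw [monom_eq_list_prod, map_list_prod, List.map_map]
  simp [Function.comp_def, rho_qx]

theorem sum_finRange_single (e : Fin n → ℕ) :
    ((List.finRange n).map fun i => (Pi.single i (e i) : Fin n → ℕ)).sum = e := by
  rw [← Fin.sum_univ_def, Finset.univ_sum_single]

theorem rho_monom_single_zero (e : Fin n → ℕ) :
    rho a (monom (qx a) e) (Finsupp.single 0 1) = Finsupp.single e 1 := by
  rw [rho_monom, list_prod_op_single_zero (List.pairwise_lt_finRange n), sum_finRange_single]

variable (k) in
/-- The sign of `x^e x^b = ± x^{e + b} + (cwlt)`. -/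
def twist (e b : Fin n → ℕ) : k := ∏ i, sgn k i b ^ e i

variable (k) in
theorem twist_mul_self (e b : Fin n → ℕ) : twist k e b * twist k e b = 1 := by
  rw [twist, ← Finset.prod_mul_distrib]
  refine Finset.prod_eq_one fun i _ => ?_
  rw [← mul_pow, sgn_mul_self, one_pow]

theorem rho_monom_single (e b : Fin n → ℕ) (c : k) :
    Lead (rho a (monom (qx a) e) (Finsupp.single b c)) (b + e) (twist k e b * c) := by
  have := list_prod_op_single (a := a) (List.pairwise_lt_finRange n) e b c
  rwa [← rho_monom, sum_finRange_single, ← Fin.prod_univ_def] at this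

theorem qx_mul_pow (i j : Fin n) (m : ℕ) :
    ∃ (c d : k) (m' : ℕ), qx a i * qx a j ^ m =
      c • (qx a j ^ m * qx a i) + d • qx a j ^ m' := by
  refine mul_pow_of_anticommute (qx_comm_sq a i j) ?_ m
  rcases lt_trichotomy i j with h | h | h
  · exact Or.inr ⟨_, qx_rel a h⟩
  · exact Or.inl (by rw [h])
  · exact Or.inr ⟨_, (add_comm _ _).trans (qx_rel a h)⟩

/-- The variable is pushed right until it meets its own power. Each exchange leaves a term that is
already ordered, which keeps the induction on the list going. -/
theorem qx_mul_list_prod_mem (i : Fin n) (L : List (Fin n)) (hL : L.Nodup) (hi : i ∈ L)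
    (e : Fin n → ℕ) : qx a i * (L.map fun j => qx a j ^ e j).prod ∈
      Submodule.span k (Set.range fun e : Fin n → ℕ => (L.map fun j => qx a j ^ e j).prod) := by
  induction L generalizing e with
  | nil => simp at hi
  | cons j L ih =>
    rw [List.nodup_cons] at hL
    have key : ∀ (m : ℕ) (e : Fin n → ℕ), qx a j ^ m * (L.map fun j => qx a j ^ e j).prod ∈
        Submodule.span k
          (Set.range fun e : Fin n → ℕ => ((j :: L).map fun j => qx a j ^ e j).prod) := by
      intro m e
      refine Submodule.subset_span ⟨Function.update e j m, ?_⟩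
      dsimp only
      rw [List.map_cons, List.prod_cons, Function.update_self]
      congr 2
      refine List.map_congr_left fun l hl => ?_
      rw [Function.update_of_ne]
      rintro rfl
      exact hL.1 hl
    rw [List.map_cons, List.prod_cons, ← mul_assoc]
    by_cases hij : i = j
    · subst hij
      rw [← pow_succ']
      exact key _ _
    · have hiL : i ∈ L := by simpa [hij] using hi
      obtain ⟨c, d, m', h⟩ := qx_mul_pow a i j (e j)
      rw [h, add_mul, smul_mul_assoc, smul_mul_assoc, mul_assoc]
      refine add_mem (Submodule.smul_mem _ _ ?_) (Submodule.smul_mem _ _ (key _ _))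
      have hmem := Submodule.mem_map_of_mem (f := LinearMap.mulLeft k (qx a j ^ e j))
        (ih hL.2 hiL e)
      rw [Submodule.map_span] at hmem
      refine Submodule.span_le.2 ?_ hmem
      rintro _ ⟨_, ⟨e', rfl⟩, rfl⟩
      exact key _ _

theorem span_monom : Submodule.span k (Set.range (monom (qx a))) = ⊤ := by
  have hx : ∀ i, ∀ s ∈ Submodule.span k (Set.range (monom (qx a))),
      qx a i * s ∈ Submodule.span k (Set.range (monom (qx a))) := by
    intro i s hs
    have hmem := Submodule.mem_map_of_mem (f := LinearMap.mulLeft k (qx a i)) hs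
    rw [Submodule.map_span] at hmem
    refine Submodule.span_le.2 ?_ hmem
    rintro _ ⟨_, ⟨e, rfl⟩, rfl⟩
    have := qx_mul_list_prod_mem a i _ (List.nodup_finRange n) (List.mem_finRange i) e
    simpa only [LinearMap.mulLeft_apply, SetLike.mem_coe, monom_eq_list_prod,
      show monom (qx a) = fun e => ((List.finRange n).map fun i => qx a i ^ e i).prod from
        funext (monom_eq_list_prod a)] using this
  have hp : ∀ p : FreeAlgebra k (Fin n), ∀ s ∈ Submodule.span k (Set.range (monom (qx a))),
      RingQuot.mkAlgHom k (QWeylRel a) p * s ∈ Submodule.span k (Set.range (monom (qx a))) := by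
    intro p
    induction p using FreeAlgebra.induction with
    | grade0 r =>
      intro s hs
      rw [AlgHom.commutes, ← Algebra.smul_def]
      exact Submodule.smul_mem _ _ hs
    | grade1 i => exact hx i
    | mul p q hp hq => intro s hs; rw [map_mul, mul_assoc]; exact hp _ (hq _ hs)
    | add p q hp hq => intro s hs; rw [map_add, add_mul]; exact add_mem (hp _ hs) (hq _ hs)
  refine Submodule.eq_top_iff'.2 fun f => ?_
  obtain ⟨p, rfl⟩ := RingQuot.mkAlgHom_surjective k (QWeylRel a) f
  simpa using hp p 1 (Submodule.subset_span ⟨0, by simp [monom]⟩)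

/-- The basis of `Vₙ(a)` over `k` that consists of the ordered monomials. -/
def pbw : Module.Basis (Fin n → ℕ) k (QWeyl a) := by
  -- Evaluation at the vacuum is a left inverse of the map from formal combinations of monomials to
  -- the algebra; spanning makes it two-sided.
  have h1 : ((rho a).toLinearMap.flip (Finsupp.single 0 1)) ∘ₗ
      Finsupp.linearCombination k (monom (qx a)) = LinearMap.id := by
    refine Finsupp.lhom_ext fun e c => ?_
    simp only [LinearMap.comp_apply, Finsupp.linearCombination_single, map_smul,
      LinearMap.flip_apply, AlgHom.toLinearMap_apply, rho_monom_single_zero, LinearMap.id_apply]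
    simp
  refine Module.Basis.ofRepr (LinearEquiv.ofLinearMap
    ((rho a).toLinearMap.flip (Finsupp.single 0 1))
    (Finsupp.linearCombination k (monom (qx a))) h1 ?_)
  ext f
  obtain ⟨v, rfl⟩ := (LinearMap.range_eq_top.1
    ((Finsupp.range_linearCombination k).trans (span_monom a))) f
  have := LinearMap.congr_fun h1 v
  simp only [LinearMap.comp_apply, LinearMap.id_apply] at this ⊢
  rw [this]

theorem pbw_repr (f : QWeyl a) : (pbw a).repr f = rho a f (Finsupp.single 0 1) := rfl

theorem pbw_apply (e : Fin n → ℕ) : pbw a e = monom (qx a) e := by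
  apply (pbw a).repr.injective
  rw [Module.Basis.repr_self, pbw_repr, rho_monom_single_zero]

theorem repr_monom (e : Fin n → ℕ) : (pbw a).repr (monom (qx a) e) = Finsupp.single e 1 :=
  rho_monom_single_zero a e

theorem repr_mul (f g : QWeyl a) : (pbw a).repr (f * g) = rho a f ((pbw a).repr g) := by
  rw [pbw_repr, pbw_repr, map_mul, Module.End.mul_apply]

theorem lead_monom_mul (e b : Fin n → ℕ) :
    Lead ((pbw a).repr (monom (qx a) e * monom (qx a) b)) (e + b) (twist k e b) := by
  rw [repr_mul, repr_monom, add_comm e]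
  simpa using rho_monom_single a e b 1

end PBW

/-! ### Algebras with a basis of skew-commuting monomials -/

section MonomialIdentities

variable {k A : Type*} [CommRing k] [Ring A] [Algebra k A]

theorem monom_zero {n : ℕ} (x : Fin n → A) : monom x 0 = 1 := by simp [monom]

theorem monom_single {n : ℕ} (x : Fin n → A) (i : Fin n) (m : ℕ) :
    monom x (Pi.single i m) = x i ^ m := by
  induction n with
  | zero => exact i.elim0
  | succ n ih =>
    rw [monom_succ]
    cases i using Fin.cases with
    | zero =>
      have h : (fun i : Fin n => (Pi.single 0 m : Fin (n + 1) → ℕ) i.succ) = 0 := by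
        funext j
        exact Pi.single_eq_of_ne (Fin.succ_ne_zero j) _
      rw [h, monom_zero, Pi.single_eq_same, mul_one]
    | succ i =>
      have h : (fun j : Fin n => (Pi.single i.succ m : Fin (n + 1) → ℕ) j.succ) =
          Pi.single i m := by
        funext j
        by_cases hj : j = i
        · subst hj; simp
        · rw [Pi.single_eq_of_ne hj, Pi.single_eq_of_ne]
          simpa using hj
      rw [h, ih, Pi.single_eq_of_ne (Fin.succ_ne_zero i).symm, pow_zero, one_mul]

theorem commute_monom_of_even {n : ℕ} {x : Fin n → A} {z : A} (hz : ∀ j, Commute z (x j ^ 2))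
    {e : Fin n → ℕ} (he : ∀ j, Even (e j)) : Commute z (monom x e) := by
  induction n with
  | zero => simp [monom]
  | succ n ih =>
    rw [monom_succ]
    obtain ⟨s, hs⟩ := (he 0).two_dvd
    rw [hs, pow_mul]
    exact ((hz 0).pow_right s).mul_right (ih (fun j => hz j.succ) fun j => he j.succ)

theorem monom_add_of_even {n : ℕ} {x : Fin n → A} (hx : ∀ i j, Commute (x i) (x j ^ 2))
    {e : Fin n → ℕ} (he : ∀ j, Even (e j)) (c : Fin n → ℕ) :
    monom x (e + c) = monom x e * monom x c := by
  induction n with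
  | zero => simp [monom]
  | succ n ih =>
    have h := ih (x := fun i => x i.succ) (fun i j => hx _ _) (fun j => he j.succ)
      fun j => c j.succ
    have hc := (commute_monom_of_even (fun j => hx 0 (Fin.succ j)) fun j => he j.succ).pow_left
      (c 0)
    have h1 : monom (fun i => x i.succ) (fun i => (e + c) i.succ) =
        monom (fun i => x i.succ) (fun i => e i.succ) *
          monom (fun i => x i.succ) (fun i => c i.succ) := h
    rw [monom_succ, monom_succ x e, monom_succ x c, h1, Pi.add_apply, pow_add]
    simp only [mul_assoc]
    rw [← mul_assoc (monom _ _) (x 0 ^ c 0), ← hc.eq, mul_assoc]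

theorem monom_pow_of_even {n : ℕ} {x : Fin n → A} (hx : ∀ i j, Commute (x i) (x j ^ 2))
    {e : Fin n → ℕ} (he : ∀ j, Even (e j)) (N : ℕ) : monom x e ^ N = monom x (N • e) := by
  induction N with
  | zero => simp [monom_zero]
  | succ N ih => rw [pow_succ', ih, ← monom_add_of_even hx he, succ_nsmul']

end MonomialIdentities

/-- The ordered monomials in the `xᵢ` form a `k`-basis, `x^e x^b = ± x^{e + b} + (cwlt)`, and the
squares `xⱼ²` commute with all `xᵢ`. -/
structure IsSkewPBW {k B : Type*} [CommRing k] [Ring B] [Algebra k B] {n : ℕ} (x : Fin n → B)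
    (P : Module.Basis (Fin n → ℕ) k B) : Prop where
  apply_eq : ∀ e, P e = monom x e
  lead_monom_mul : ∀ e b, Lead (P.repr (monom x e * monom x b)) (e + b) (twist k e b)
  commute_sq : ∀ i j, Commute (x i) (x j ^ 2)

theorem isSkewPBW_pbw {k : Type*} [CommRing k] {n : ℕ} (a : Fin n → Fin n → k) :
    IsSkewPBW (qx a) (pbw a) :=
  ⟨pbw_apply a, lead_monom_mul a, qx_comm_sq a⟩

namespace IsSkewPBW

variable {k B : Type*} [CommRing k] [Ring B] [Algebra k B] {n : ℕ} {x : Fin n → B}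
  {P : Module.Basis (Fin n → ℕ) k B}

theorem repr_monom (h : IsSkewPBW x P) (e : Fin n → ℕ) :
    P.repr (monom x e) = Finsupp.single e 1 := by
  rw [← h.apply_eq, P.repr_self]

theorem repr_algebraMap (h : IsSkewPBW x P) (c : k) :
    P.repr (algebraMap k B c) = Finsupp.single 0 c := by
  rw [Algebra.algebraMap_eq_smul_one, map_smul, ← monom_zero x, h.repr_monom]
  simp

theorem repr_gen (h : IsSkewPBW x P) (i : Fin n) :
    P.repr (x i) = Finsupp.single (Pi.single i 1) 1 := by
  rw [← h.repr_monom, monom_single, pow_one]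

theorem eq_sum (h : IsSkewPBW x P) (f : B) :
    f = ∑ e ∈ (P.repr f).support, P.repr f e • monom x e := by
  conv_lhs => rw [← P.linearCombination_repr f]
  simp only [Finsupp.linearCombination_apply, Finsupp.sum, h.apply_eq]

/-- The leading-term rule for monomials is extended by `Lead.map` first linearly in `g`, with a
monomial on the left, and then linearly in `f`. -/
theorem lead_mul (h : IsSkewPBW x P) {f g : B} {b c : Fin n → ℕ} {β γ : k}
    (hf : Lead (P.repr f) b β) (hg : Lead (P.repr g) c γ) :
    Lead (P.repr (f * g)) (b + c) (twist k b c * β * γ) := by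
  have hm : ∀ e, Lead (P.repr (monom x e * g)) (e + c) (twist k e c * γ) := fun e => by
    have := hg.map (f := P.repr.toLinearMap ∘ₗ LinearMap.mulLeft k (monom x e) ∘ₗ
      P.repr.symm.toLinearMap) (d := e) (ε := twist k e) fun c' r => ?_
    · rw [add_comm e]
      simpa using this
    · have := (h.lead_monom_mul e c').smul r
      rw [← map_smul, ← mul_smul_comm, ← h.apply_eq c'] at this
      rw [add_comm c', mul_comm]
      have e1 : P.repr.symm (Finsupp.single c' r) = r • P c' := by
        rw [Module.Basis.repr_symm_single]
      simpa [e1] using this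
  have := hf.map (f := P.repr.toLinearMap ∘ₗ LinearMap.mulRight k g ∘ₗ
      P.repr.symm.toLinearMap) (d := c) (ε := fun e => twist k e c * γ) fun e r => ?_
  · convert this using 1
    · simp
    · ring
  · have := (hm e).smul r
    rw [← map_smul, ← smul_mul_assoc, ← h.apply_eq e] at this
    have e1 : P.repr.symm (Finsupp.single e r) = r • P e := by
      rw [Module.Basis.repr_symm_single]
    rw [mul_comm]
    simpa [e1] using this

theorem cwlt_eq (h : IsSkewPBW x P) (b : Fin n → ℕ) :
    cwlt k x b = (Finsupp.supported k k (Set.Iio b)).comap P.repr.toLinearMap := by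
  have : cwlt k x b = (Finsupp.supported k k (Set.Iio b)).map P.repr.symm.toLinearMap := by
    rw [Finsupp.supported_eq_span_single, Submodule.map_span, cwlt]
    congr 1
    ext m
    constructor
    · rintro ⟨e, h1, h2, rfl⟩
      refine ⟨_, ⟨e, Pi.lt_def.2 ⟨h1, h2⟩, rfl⟩, ?_⟩
      simpa using h.apply_eq e
    · rintro ⟨_, ⟨e, he, rfl⟩, rfl⟩
      refine ⟨e, (Pi.lt_def.1 he).1, (Pi.lt_def.1 he).2, ?_⟩
      simpa using h.apply_eq e
  rw [this]
  exact Submodule.map_equiv_eq_comap_symm P.repr.symm _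

theorem lead_iff (h : IsSkewPBW x P) {f : B} {b : Fin n → ℕ} {c : k} :
    Lead (P.repr f) b c ↔ f - c • monom x b ∈ cwlt k x b := by
  rw [h.cwlt_eq, Lead.iff_sub_mem_supported, Submodule.mem_comap]
  simp [h.repr_monom]

/-! ### The standard filtration -/

/-- In total degree at least `i + j` the lower terms of `x^e x^b` cannot contribute, so the product
is a convolution twisted by signs. -/
theorem repr_mul_apply (h : IsSkewPBW x P) {f g : B} {i j : ℕ} {d : Fin n → ℕ}
    (hf : ∀ e, P.repr f e ≠ 0 → ∑ l, e l ≤ i) (hg : ∀ e, P.repr g e ≠ 0 → ∑ l, e l ≤ j)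
    (hd : i + j ≤ ∑ l, d l) : P.repr (f * g) d = ∑ e ∈ (P.repr f).support,
      ∑ b ∈ (P.repr g).support, if e + b = d then P.repr f e * P.repr g b * twist k e b else 0 := by
  conv_lhs => rw [h.eq_sum f, h.eq_sum g, Finset.sum_mul_sum]
  simp only [map_sum, Finsupp.finsetSum_apply]
  refine Finset.sum_congr rfl fun e he => Finset.sum_congr rfl fun b hb => ?_
  rw [smul_mul_smul_comm, map_smul, Finsupp.smul_apply, smul_eq_mul]
  have hl := h.lead_monom_mul e b
  split_ifs with hebd
  · rw [← hebd, hl.coeff]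
  · by_contra hne
    have hle := hl.le d fun h0 => hne (by rw [h0, mul_zero])
    have h1 := hf e (Finsupp.mem_support_iff.1 he)
    have h2 := hg b (Finsupp.mem_support_iff.1 hb)
    have h3 : ∑ l, d l < ∑ l, (e + b) l := by
      obtain ⟨l, hl⟩ := (Pi.lt_def.1 (lt_of_le_of_ne hle (Ne.symm hebd))).2
      exact Finset.sum_lt_sum (fun l _ => hle l) ⟨l, Finset.mem_univ l, hl⟩
    simp only [Pi.add_apply, Finset.sum_add_distrib] at h3
    omega

theorem mem_piece_iff (h : IsSkewPBW x P) {f : B} {m : ℕ} :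
    f ∈ (stdFiltration k x).piece m ↔ ∀ e, P.repr f e ≠ 0 → ∑ l, e l ≤ m := by
  let D : ℕ → Submodule k B := fun m =>
    (Finsupp.supported k k {e : Fin n → ℕ | ∑ l, e l ≤ m}).comap P.repr.toLinearMap
  have hD : ∀ m f, f ∈ D m ↔ ∀ e, P.repr f e ≠ 0 → ∑ l, e l ≤ m := by
    intro m f
    simp only [D, Submodule.mem_comap, Finsupp.mem_supported']
    exact forall_congr' fun e => not_imp_comm
  have h1 : (1 ⊔ genSpan k x : Submodule k B) ≤ D 1 := by
    refine sup_le ?_ (Submodule.span_le.2 ?_)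
    · rw [Submodule.one_le, hD, ← monom_zero x, h.repr_monom]
      intro e he
      rw [Finsupp.single_apply_ne_zero] at he
      simp [he.1]
    · rintro _ ⟨i, rfl⟩
      rw [SetLike.mem_coe, hD, h.repr_gen]
      intro e he
      rw [Finsupp.single_apply_ne_zero] at he
      simp [he.1]
  constructor
  · intro hf
    rw [← hD]
    refine (show (1 ⊔ genSpan k x : Submodule k B) ^ m ≤ D m from ?_) hf
    clear hf
    induction m with
    | zero =>
      rw [pow_zero, Submodule.one_le, hD, ← monom_zero x, h.repr_monom]
      intro e he
      rw [Finsupp.single_apply_ne_zero] at he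
      simp [he.1]
    | succ m ih =>
      rw [pow_succ]
      refine (mul_le_mul' ih h1).trans (Submodule.mul_le.2 fun f hf g hg => ?_)
      rw [hD] at hf hg ⊢
      intro d hd
      by_contra! hlt
      refine hd ?_
      rw [h.repr_mul_apply hf hg hlt.le]
      refine Finset.sum_eq_zero fun e he => Finset.sum_eq_zero fun b hb => if_neg ?_
      rintro rfl
      have h1 := hf e (Finsupp.mem_support_iff.1 he)
      have h2 := hg b (Finsupp.mem_support_iff.1 hb)
      simp only [Pi.add_apply, Finset.sum_add_distrib] at hlt
      omega
  · intro hf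
    rw [h.eq_sum f]
    refine sum_mem fun e he => Submodule.smul_mem _ _ ?_
    refine (stdFiltration k x).mono (hf e (Finsupp.mem_support_iff.1 he)) ?_
    have := monom_mem_piece (F := stdFiltration k x) (y := x) (d := fun _ => 1) (fun i => ?_) e
    · simpa using this
    · change x i ∈ (1 ⊔ genSpan k x) ^ 1
      rw [pow_one]
      exact Submodule.mem_sup_right (Submodule.subset_span ⟨i, rfl⟩)

theorem mem_prev_iff (h : IsSkewPBW x P) {f : B} {m : ℕ} :
    f ∈ (stdFiltration k x).prev m ↔ ∀ e, P.repr f e ≠ 0 → ∑ l, e l < m := by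
  cases m with
  | zero =>
    simp only [AlgFiltration.prev, Submodule.mem_bot, not_lt_zero, imp_false, not_not]
    rw [← P.repr.map_eq_zero_iff, Finsupp.ext_iff]
    rfl
  | succ m =>
    simp only [Nat.lt_succ_iff]
    exact h.mem_piece_iff

theorem nontrivial [Nontrivial k] (h : IsSkewPBW x P) : Nontrivial B := by
  refine ⟨⟨1, 0, fun h0 => ?_⟩⟩
  have := h.repr_monom 0
  rw [monom_zero, h0, map_zero] at this
  simpa using congrArg (fun v => v 0) this

theorem algebraMap_injective (h : IsSkewPBW x P) : Function.Injective (algebraMap k B) := by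
  intro c d hcd
  have := congrArg P.repr hcd
  rw [h.repr_algebraMap, h.repr_algebraMap] at this
  exact Finsupp.single_injective _ this

/-- The top-degree supports are finite nonempty sets of exponents, and in `ℕⁿ` two such sets have a
sum attained by only one pair. Its coefficient is a product of two nonzero coefficients and a sign.
-/
theorem isDomain_gr [IsDomain k] (h : IsSkewPBW x P) : IsDomain (stdFiltration k x).Gr := by
  have := h.nontrivial
  refine AlgFiltration.isDomain_gr _ fun {i j s t} hs hs' ht ht' hst => ?_
  rw [h.mem_piece_iff] at hs ht
  rw [h.mem_prev_iff] at hs' ht' hst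
  push Not at hs' ht'
  have nonempty : ∀ {i : ℕ} {s : B}, (∃ e, P.repr s e ≠ 0 ∧ i ≤ ∑ l, e l) →
      ((P.repr s).support.filter fun e => i ≤ ∑ l, e l).Nonempty := by
    rintro i s ⟨e, he, hi⟩
    exact ⟨e, Finset.mem_filter.2 ⟨Finsupp.mem_support_iff.2 he, hi⟩⟩
  obtain ⟨e₀, he₀, b₀, hb₀, huniq⟩ :=
    UniqueSums.uniqueAdd_of_nonempty (nonempty hs') (nonempty ht')
  rw [Finset.mem_filter] at he₀ hb₀
  have hd : ∑ l, (e₀ + b₀) l = ∑ l, e₀ l + ∑ l, b₀ l := Finset.sum_add_distrib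
  have key := h.repr_mul_apply hs ht (d := e₀ + b₀) (by omega)
  rw [Finset.sum_eq_single_of_mem e₀ he₀.1, Finset.sum_eq_single_of_mem b₀ hb₀.1,
    if_pos rfl] at key
  · have htw : twist k e₀ b₀ ≠ 0 := fun h0 => by
      have := twist_mul_self k e₀ b₀
      simp [h0] at this
    have := hst (e₀ + b₀) (by
      rw [key]
      exact mul_ne_zero (mul_ne_zero (Finsupp.mem_support_iff.1 he₀.1)
        (Finsupp.mem_support_iff.1 hb₀.1)) htw)
    omega
  · intro b hb hne
    exact if_neg fun hh => hne (add_left_cancel hh)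
  · intro e he hne
    refine Finset.sum_eq_zero fun b hb => if_neg fun hh => ?_
    have h1 := hs e (Finsupp.mem_support_iff.1 he)
    have h2 := ht b (Finsupp.mem_support_iff.1 hb)
    have h3 : ∑ l, (e + b) l = ∑ l, e l + ∑ l, b l := Finset.sum_add_distrib
    rw [hh] at h3
    exact hne (huniq (Finset.mem_filter.2 ⟨he, by omega⟩)
      (Finset.mem_filter.2 ⟨hb, by omega⟩) hh).1

theorem isFilteredDomain [IsDomain k] (h : IsSkewPBW x P) : IsFilteredDomain k x := by
  have hx : x = P ∘ fun i => Pi.single i 1 := by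
    funext i
    rw [Function.comp_apply, h.apply_eq, monom_single, pow_one]
  refine ⟨?_, ?_, fun f => ?_, ⟨h.algebraMap_injective, rfl⟩, h.isDomain_gr⟩
  · rw [hx]
    refine P.linearIndependent.comp _ fun i j hij => ?_
    by_contra hne
    have := congrFun hij i
    simp [Pi.single_eq_of_ne hne] at this
  · rw [Submodule.disjoint_def]
    intro f hf hf'
    obtain ⟨c, rfl⟩ := Submodule.mem_one.1 hf
    have hle : genSpan k x ≤ LinearMap.ker (P.coord 0) := by
      refine Submodule.span_le.2 ?_
      rintro _ ⟨i, rfl⟩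
      rw [SetLike.mem_coe, LinearMap.mem_ker, P.coord_apply, h.repr_gen, Finsupp.single_apply,
        if_neg]
      intro h0
      simpa using congrFun h0 i
    have := hle hf'
    rw [LinearMap.mem_ker, P.coord_apply, h.repr_algebraMap] at this
    rw [show c = 0 by simpa using this, map_zero]
  · refine ⟨(P.repr f).support.sup fun e => ∑ l, e l, ?_⟩
    rw [h.mem_piece_iff]
    intro e he
    exact Finset.le_sup (f := fun e : Fin n → ℕ => ∑ l, e l) (Finsupp.mem_support_iff.2 he)

/-! ### The subalgebra of the squares and the center -/

/-- Even monomials multiply without signs or lower terms, so their span is already closed under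
multiplication. -/
theorem mem_adjoin_sq_iff (h : IsSkewPBW x P) {f : B} :
    f ∈ Algebra.adjoin k (Set.range fun i => x i ^ 2) ↔
      ∀ e, P.repr f e ≠ 0 → ∀ i, Even (e i) := by
  let S : Set B := {m | ∃ e : Fin n → ℕ, (∀ i, Even (e i)) ∧ m = monom x e}
  have hmem : ∀ e : Fin n → ℕ, (∀ i, Even (e i)) →
      monom x e ∈ Algebra.adjoin k (Set.range fun i => x i ^ 2) := by
    intro e he
    refine list_prod_mem fun y hy => ?_
    obtain ⟨i, rfl⟩ := List.mem_ofFn.1 hy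
    obtain ⟨s, hs⟩ := (he i).two_dvd
    rw [hs, pow_mul]
    exact pow_mem (Algebra.subset_adjoin (Set.mem_range_self (f := fun i => x i ^ 2) i)) s
  constructor
  · intro hf
    have hS : f ∈ Submodule.span k S := by
      induction hf using Algebra.adjoin_induction with
      | mem y hy =>
        obtain ⟨i, rfl⟩ := hy
        refine Submodule.subset_span ⟨Pi.single i 2, fun j => ?_, (monom_single x i 2).symm⟩
        by_cases hj : j = i
        · subst hj; simp
        · simp [Pi.single_eq_of_ne hj]
      | algebraMap r =>
        rw [Algebra.algebraMap_eq_smul_one]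
        exact Submodule.smul_mem _ _
          (Submodule.subset_span ⟨0, fun j => by simp, (monom_zero x).symm⟩)
      | add y z _ _ hy hz => exact add_mem hy hz
      | mul y z _ _ hy hz =>
        have := Submodule.mul_mem_mul hy hz
        rw [Submodule.span_mul_span] at this
        refine Submodule.span_mono ?_ this
        rintro _ ⟨_, ⟨e, he, rfl⟩, _, ⟨b, hb, rfl⟩, rfl⟩
        exact ⟨e + b, fun i => (he i).add (hb i), (monom_add_of_even h.commute_sq he b).symm⟩
    have hle : Submodule.span k S ≤ (Finsupp.supported k k
        {e : Fin n → ℕ | ∀ i, Even (e i)}).comap P.repr.toLinearMap := by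
      refine Submodule.span_le.2 ?_
      rintro _ ⟨e, he, rfl⟩
      simpa [h.repr_monom] using Finsupp.single_mem_supported k (1 : k)
        (show e ∈ {e : Fin n → ℕ | ∀ i, Even (e i)} from he)
    have hsup := hle hS
    rw [Submodule.mem_comap, Finsupp.mem_supported'] at hsup
    exact fun e he => by_contra fun hne => he (hsup e hne)
  · intro hf
    rw [h.eq_sum f]
    exact sum_mem fun e he =>
      Subalgebra.smul_mem _ (hmem e (hf e (Finsupp.mem_support_iff.1 he))) _

theorem adjoin_sq_le_center (h : IsSkewPBW x P) :
    Algebra.adjoin k (Set.range fun i => x i ^ 2) ≤ Subalgebra.center k B := by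
  intro f hf
  rw [h.mem_adjoin_sq_iff] at hf
  rw [h.eq_sum f]
  refine sum_mem fun e he => Subalgebra.smul_mem _ ?_ _
  have he' := hf e (Finsupp.mem_support_iff.1 he)
  rw [Subalgebra.mem_center_iff]
  intro b
  rw [h.eq_sum b, Finset.sum_mul, Finset.mul_sum]
  refine Finset.sum_congr rfl fun c _ => ?_
  rw [smul_mul_assoc, mul_smul_comm]
  congr 1
  refine (commute_monom_of_even (fun j => ?_) he').eq
  refine (List.prod_induction (fun z => Commute (x j ^ 2) z) (fun _ _ => Commute.mul_right)
    (Commute.one_right _) fun y hy => ?_).symm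
  obtain ⟨i, rfl⟩ := List.mem_ofFn.1 hy
  exact (h.commute_sq i j).symm.pow_right _

theorem center_eq [IsDomain k] (h2 : (2 : k) ≠ 0) (hn : Even n) (h : IsSkewPBW x P) :
    Subalgebra.center k B = Algebra.adjoin k (Set.range fun i => x i ^ 2) := by
  classical
  refine le_antisymm (fun f hf => ?_) h.adjoin_sq_le_center
  -- The even part of `f` is central, so it may be removed; the remaining central element has only
  -- exponents with some odd entry and must be shown to vanish.
  let v : (Fin n → ℕ) →₀ k := (P.repr f).filter fun e => ∀ i, Even (e i)
  have hv : P.repr.symm v ∈ Algebra.adjoin k (Set.range fun i => x i ^ 2) := by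
    rw [h.mem_adjoin_sq_iff, LinearEquiv.apply_symm_apply]
    intro e he
    by_contra hc
    exact he (Finsupp.filter_apply_neg _ _ hc)
  suffices hg : f - P.repr.symm v = 0 by
    rw [sub_eq_zero] at hg
    rw [hg]; exact hv
  have hgc : f - P.repr.symm v ∈ Subalgebra.center k B :=
    sub_mem hf (h.adjoin_sq_le_center hv)
  have hgo : ∀ e, P.repr (f - P.repr.symm v) e ≠ 0 → ∃ i, ¬ Even (e i) := by
    intro e he
    by_contra! hc
    refine he ?_
    rw [map_sub, LinearEquiv.apply_symm_apply, Finsupp.sub_apply,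
      Finsupp.filter_apply_pos _ _ hc, sub_self]
  generalize f - P.repr.symm v = g at hgc hgo
  by_contra hg0
  have hne : (P.repr g).support.Nonempty := by
    rw [Finsupp.support_nonempty_iff]
    exact fun h0 => hg0 ((P.repr.map_eq_zero_iff).1 h0)
  obtain ⟨e, he, hmax⟩ := Finset.exists_max_image _ (fun e : Fin n → ℕ => ∑ l, e l) hne
  have hgm : ∀ e', P.repr g e' ≠ 0 → ∑ l, e' l ≤ ∑ l, e l := fun e' he' =>
    hmax e' (Finsupp.mem_support_iff.2 he')
  have hxm : ∀ i e', P.repr (x i) e' ≠ 0 → ∑ l, e' l ≤ 1 := by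
    intro i e' he'
    rw [h.repr_gen, Finsupp.single_apply_ne_zero] at he'
    simp [he'.1]
  have hsupp : ∀ i, (P.repr (x i)).support = {Pi.single i 1} := by
    intro i
    rw [h.repr_gen, Finsupp.support_single _ one_ne_zero]
  -- Since `e` has maximal total degree in `g`, the coefficient of `x^{e + δᵢ}` in `xᵢ g = g xᵢ`
  -- comes from `e` alone on either side, and the two signs agree.
  have htw : ∀ i, twist k (Pi.single i 1) e = twist k e (Pi.single i 1) := by
    intro i
    have hl := h.repr_mul_apply (hxm i) hgm (d := e + Pi.single i 1)
      (by simp [Finset.sum_add_distrib, add_comm])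
    have hr := h.repr_mul_apply hgm (hxm i) (d := e + Pi.single i 1)
      (by simp [Finset.sum_add_distrib])
    rw [hsupp, Finset.sum_singleton, Finset.sum_eq_single_of_mem e he, if_pos (add_comm _ _)] at hl
    · rw [hsupp, Finset.sum_eq_single_of_mem e he, Finset.sum_singleton, if_pos rfl] at hr
      · rw [Subalgebra.mem_center_iff.1 hgc (x i), hr, h.repr_gen, Finsupp.single_eq_same, one_mul,
          mul_one] at hl
        exact (mul_left_cancel₀ (Finsupp.mem_support_iff.1 he) hl).symm
      · intro b _ hb
        rw [Finset.sum_singleton, if_neg fun hh => hb (add_right_cancel hh)]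
    · intro b _ hb
      exact if_neg fun hh => hb (by rw [add_comm] at hh; exact add_right_cancel hh)
  have h11 : (-1 : k) ≠ 1 := fun hh => h2 (by
    have : (1 : k) + 1 = 0 := by nth_rewrite 1 [← hh]; ring
    rw [← this]; norm_num)
  -- The signs are `(-1)` to the sums of `eⱼ` over `j < i` and over `j > i`; their equality, with
  -- `-1 ≠ 1`, makes the sum over `j ≠ i` even.
  have heven : ∀ i, Even (∑ j ∈ Finset.univ.erase i, e j) := by
    intro i
    have hs1 : twist k (Pi.single i 1) e = (-1) ^ ∑ j ∈ Finset.Iio i, e j := by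
      rw [twist, Finset.prod_eq_single i, Pi.single_eq_same, pow_one, sgn]
      · intro j _ hj
        rw [Pi.single_eq_of_ne hj, pow_zero]
      · simp
    have hs2 : twist k e (Pi.single i 1) = (-1) ^ ∑ j ∈ Finset.Ioi i, e j := by
      rw [twist, ← Finset.prod_pow_eq_pow_sum, ← Finset.prod_subset (Finset.subset_univ
        (Finset.Ioi i))]
      · refine Finset.prod_congr rfl fun j hj => ?_
        rw [sgn, Finset.sum_pi_single', if_pos (by simpa using hj), pow_one]
      · intro j _ hj
        rw [sgn, Finset.sum_pi_single', if_neg (by simpa using hj), pow_zero, one_pow]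
    have hu : Finset.univ.erase i = Finset.Iio i ∪ Finset.Ioi i := by
      ext j
      simp
    have hpow := htw i
    rw [hs1, hs2] at hpow
    rw [hu, Finset.sum_union (Finset.disjoint_left.2 fun j h1 h2 =>
      lt_asymm (Finset.mem_Iio.1 h1) (Finset.mem_Ioi.1 h2))]
    by_contra ho
    rw [Nat.even_add] at ho
    rcases Nat.even_or_odd (∑ j ∈ Finset.Iio i, e j) with h1 | h1 <;>
      rcases Nat.even_or_odd (∑ j ∈ Finset.Ioi i, e j) with h2 | h2
    · exact ho (by simp [h1, h2])
    · rw [h1.neg_one_pow, h2.neg_one_pow] at hpow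
      exact h11 hpow.symm
    · rw [h1.neg_one_pow, h2.neg_one_pow] at hpow
      exact h11 hpow
    · exact ho (by simp [Nat.not_even_iff_odd.2 h1, Nat.not_even_iff_odd.2 h2])
  obtain ⟨i, hi⟩ := hgo e (Finsupp.mem_support_iff.1 he)
  have hpar : ∀ j, Even (e j) ↔ Even (∑ l, e l) := by
    intro j
    rw [← Finset.add_sum_erase _ _ (Finset.mem_univ j), Nat.even_add]
    simp [heven j]
  have hodd : ∀ j, e j % 2 = 1 := fun j => by
    rw [← Nat.odd_iff, ← Nat.not_even_iff_odd, hpar j, ← hpar i]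
    exact hi
  -- All entries have the parity of the total degree. If all are odd, the total is congruent to `n`,
  -- hence even: a contradiction.
  refine hi ((hpar i).2 ?_)
  rw [Nat.even_iff, Finset.sum_nat_mod, Finset.sum_congr rfl fun j _ => hodd j]
  simpa [Nat.even_iff] using hn

end IsSkewPBW

/-! ### Discriminants over a central subalgebra -/

section GeneralDiscriminant

/-- The Gram matrix transforms as `A G Aᵀ`. Applied to arbitrary families this makes the
discriminant ideal principal; applied to bases it gives a unit square. -/
theorem det_gram {R B ι : Type*} [CommRing R] [Ring B] [Algebra R B] [Fintype ι] [DecidableEq ι]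
    (tr : B →ₗ[R] R) (A : Matrix ι ι R) (z : ι → B) :
    (Matrix.of fun i j => tr ((∑ l, A i l • z l) * ∑ m, A j m • z m)).det =
      A.det * A.det * (Matrix.of fun i j => tr (z i * z j)).det := by
  have : (Matrix.of fun i j => tr ((∑ l, A i l • z l) * ∑ m, A j m • z m)) =
      A * (Matrix.of fun i j => tr (z i * z j)) * A.transpose := by
    ext i j
    simp only [Matrix.of_apply, Matrix.mul_apply, Matrix.transpose_apply, Finset.sum_mul,
      Finset.mul_sum, map_sum]
    refine Finset.sum_congr rfl fun l _ => Finset.sum_congr rfl fun m _ => ?_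
    rw [smul_mul_smul_comm, map_smul, smul_eq_mul]
    ring
  rw [this, Matrix.det_mul, Matrix.det_mul, Matrix.det_transpose]
  ring

variable {k B : Type*} [CommRing k] [Ring B] [Algebra k B] {R : Subalgebra k B}
  (hR : R ≤ Subalgebra.center k B)

theorem regularTrace_eq_sum {ι : Type*} [Fintype ι] [DecidableEq ι] (z : Module.Basis ι R B)
    (b : B) : regularTrace R hR b = ∑ i, z.repr (b * z i) i := by
  let := centralCommRing R hR
  let := centralAlgebra R hR
  change LinearMap.trace R B (Algebra.lmul R B b) = _
  rw [LinearMap.trace_eq_matrix_trace R z, Matrix.trace]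
  refine Finset.sum_congr rfl fun i _ => ?_
  rw [Matrix.diag_apply, LinearMap.toMatrix_apply]
  rfl

theorem exists_disc_eq_mul {w : ℕ} (Z : Module.Basis (Fin w) R B) (z : Fin w → B) :
    ∃ r : R, disc R hR z = r * disc R hR Z := by
  let := centralCommRing R hR
  let := centralAlgebra R hR
  have h := det_gram (LinearMap.trace R B ∘ₗ (Algebra.lmul R B).toLinearMap)
    (Matrix.of fun i j => Z.repr (z i) j) Z
  simp only [Matrix.of_apply, Z.sum_repr] at h
  exact ⟨_, h⟩

theorem exists_disc_eq_unit_mul {w : ℕ} (Z Z' : Module.Basis (Fin w) R B) :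
    ∃ u v : R, u * v = 1 ∧ disc R hR Z' = u * u * disc R hR Z := by
  let := centralCommRing R hR
  let := centralAlgebra R hR
  have h := det_gram (LinearMap.trace R B ∘ₗ (Algebra.lmul R B).toLinearMap)
    (Matrix.of fun i j => Z.repr (Z' i) j) Z
  simp only [Matrix.of_apply, Z.sum_repr] at h
  have hu : IsUnit (Matrix.of fun i j => Z.repr (Z' i) j).det := by
    have := Z.isUnit_det Z'
    rw [Module.Basis.det_apply, ← Matrix.det_transpose] at this
    exact this
  obtain ⟨v, hv⟩ := hu.exists_right_inv
  exact ⟨_, v, hv, h⟩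

theorem discIdeal_eq_span {w : ℕ} (Z : Module.Basis (Fin w) R B) :
    discIdeal R hR w = Ideal.span {disc R hR Z} := by
  refine le_antisymm (Ideal.span_le.2 ?_) (Ideal.span_mono ?_)
  · rintro _ ⟨z, rfl⟩
    obtain ⟨r, hr⟩ := exists_disc_eq_mul hR Z z
    rw [SetLike.mem_coe]
    dsimp only
    rw [hr]
    exact Ideal.mul_mem_left _ r (Ideal.subset_span rfl)
  · rintro _ rfl
    exact ⟨Z, rfl⟩

theorem exists_basis_map {w : ℕ} (Z : Module.Basis (Fin w) R B) (g : B ≃ₐ[k] B)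
    (h1 : ∀ r ∈ R, g r ∈ R) (h2 : ∀ r ∈ R, g.symm r ∈ R) :
    ∃ Z' : Module.Basis (Fin w) R B, ∀ i, Z' i = g (Z i) := by
  have hli : LinearIndependent R fun i => g (Z i) := by
    rw [Fintype.linearIndependent_iff]
    intro r hr i
    have h0 : ∑ i, (⟨g.symm (r i), h2 _ (r i).2⟩ : R) • Z i = 0 := by
      apply g.injective
      rw [map_sum, map_zero, ← hr]
      refine Finset.sum_congr rfl fun i _ => ?_
      rw [Subalgebra.smul_def, Subalgebra.smul_def, smul_eq_mul, smul_eq_mul, map_mul,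
        AlgEquiv.apply_symm_apply]
    have := Fintype.linearIndependent_iff.1 Z.linearIndependent _ h0 i
    have h3 : g.symm (r i : B) = 0 := congrArg Subtype.val this
    exact Subtype.ext ((map_eq_zero_iff _ g.symm.injective).1 h3)
  refine ⟨Module.Basis.mk hli fun f _ => ?_, fun i => Module.Basis.mk_apply _ _ i⟩
  have hf : f = ∑ i, (⟨g (Z.repr (g.symm f) i), h1 _ (Z.repr (g.symm f) i).2⟩ : R) • g (Z i) := by
    conv_lhs => rw [← g.apply_symm_apply f, ← Z.sum_repr (g.symm f), map_sum]
    refine Finset.sum_congr rfl fun i _ => ?_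
    rw [Subalgebra.smul_def, Subalgebra.smul_def, smul_eq_mul, smul_eq_mul, map_mul]
  rw [hf]
  exact sum_mem fun i _ => Submodule.smul_mem _ _ (Submodule.subset_span ⟨i, rfl⟩)

/-- In the transported basis, left multiplication by `g b` has the matrix of `b` with `g` applied to
its entries, and the trace does not depend on the basis. As `g` is only semilinear over `R`,
coordinates are compared directly. -/
theorem regularTrace_map {w : ℕ} (Z : Module.Basis (Fin w) R B) (g : B ≃ₐ[k] B)
    (h1 : ∀ r ∈ R, g r ∈ R) (h2 : ∀ r ∈ R, g.symm r ∈ R) (b : B) :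
    (regularTrace R hR (g b) : B) = g (regularTrace R hR b) := by
  obtain ⟨Z', hZ'⟩ := exists_basis_map Z g h1 h2
  have hrepr : ∀ f i, Z'.repr (g f) i = ⟨g (Z.repr f i), h1 _ (Z.repr f i).2⟩ := by
    intro f i
    have hf : g f = ∑ i, (⟨g (Z.repr f i), h1 _ (Z.repr f i).2⟩ : R) • Z' i := by
      conv_lhs => rw [← Z.sum_repr f, map_sum]
      refine Finset.sum_congr rfl fun i _ => ?_
      rw [Subalgebra.smul_def, Subalgebra.smul_def, smul_eq_mul, smul_eq_mul, map_mul, hZ']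
    rw [hf, Z'.repr_sum_self]
  rw [regularTrace_eq_sum hR Z', regularTrace_eq_sum hR Z, AddSubmonoidClass.coe_finsetSum,
    AddSubmonoidClass.coe_finsetSum, map_sum]
  refine Finset.sum_congr rfl fun i _ => ?_
  rw [hZ', ← map_mul, hrepr]

theorem disc_map {w : ℕ} (Z : Module.Basis (Fin w) R B) (g : B ≃ₐ[k] B)
    (h1 : ∀ r ∈ R, g r ∈ R) (h2 : ∀ r ∈ R, g.symm r ∈ R) (z : Fin w → B) :
    (disc R hR (fun i => g (z i)) : B) = g (disc R hR z) := by
  let := centralCommRing R hR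
  let φ : R →+* R :=
    { toFun := fun r => ⟨g r, h1 r r.2⟩
      map_one' := Subtype.ext (map_one g)
      map_zero' := Subtype.ext (map_zero g)
      map_add' := fun r s => Subtype.ext (map_add g r.1 s.1)
      map_mul' := fun r s => Subtype.ext (map_mul g r.1 s.1) }
  have h := φ.map_det (Matrix.of fun i j => regularTrace R hR (z i * z j))
  have hM : φ.mapMatrix (Matrix.of fun i j => regularTrace R hR (z i * z j)) =
      Matrix.of fun i j => regularTrace R hR (g (z i) * g (z j)) := by
    ext i j
    rw [Matrix.of_apply, ← map_mul, regularTrace_map hR Z g h1 h2]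
    rfl
  rw [hM] at h
  exact (congrArg Subtype.val h).symm

end GeneralDiscriminant

/-! ### The discriminant over the subalgebra of the squares -/

section Indicator

variable {n : ℕ}

/-- The exponent vector that is `c` on `U` and `0` elsewhere. -/
def ind (c : ℕ) (U : Finset (Fin n)) : Fin n → ℕ := fun i => if i ∈ U then c else 0

theorem even_ind_two (U : Finset (Fin n)) (i : Fin n) : Even (ind 2 U i) := by
  unfold ind; split_ifs <;> simp

theorem sum_ind : ∑ S : Finset (Fin n), ind 2 S = fun _ => 2 * 2 ^ (n - 1) := by
  funext i
  have hc : (Finset.univ.filter fun S : Finset (Fin n) => i ∈ S).card = 2 ^ (n - 1) := by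
    rw [show 2 ^ (n - 1) = (Finset.univ.erase i).powerset.card by simp]
    refine Finset.card_nbij' (fun S => S.erase i) (fun S => insert i S) ?_ ?_ ?_ ?_
    · intro S _
      simp
    · intro S _
      simp
    · intro S hS
      exact Finset.insert_erase (by simpa using hS)
    · intro S hS
      exact Finset.erase_insert fun hi =>
        Finset.notMem_erase i _ (Finset.mem_powerset.1 hS hi)
  rw [Finset.sum_apply]
  simp only [ind]
  rw [← Finset.sum_filter, Finset.sum_const, hc, smul_eq_mul, mul_comm]

/-- If `S ⊆ σ S` held for all `S`, then comparing the total cardinalities would force `σ = 1`. So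
some `S` loses an element on intersecting with `σ S`. -/
theorem sum_ind_inter_lt {σ : Equiv.Perm (Finset (Fin n))} (hσ : σ ≠ 1) :
    ∑ S, ind 2 (σ S ∩ S) < ∑ S : Finset (Fin n), ind 2 S := by
  obtain ⟨S, hS⟩ : ∃ S, ¬ S ⊆ σ S := by
    by_contra! hc
    refine hσ (Equiv.ext fun S => ?_)
    have hsum : ∑ S : Finset (Fin n), S.card = ∑ S, (σ S).card :=
      (Equiv.sum_comp σ fun S : Finset (Fin n) => S.card).symm
    have := (Finset.sum_eq_sum_iff_of_le fun S _ => Finset.card_le_card (hc S)).1 hsum S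
      (Finset.mem_univ S)
    exact (Finset.eq_of_subset_of_card_le (hc S) this.ge).symm
  have hle : ∀ T : Finset (Fin n), ind 2 (σ T ∩ T) ≤ ind 2 T := by
    intro T i
    simp only [ind, Finset.mem_inter]
    split_ifs <;> simp_all
  refine Finset.sum_lt_sum (fun T _ => hle T) ⟨S, Finset.mem_univ S, ?_⟩
  obtain ⟨i, hi, hi'⟩ := Finset.not_subset.1 hS
  refine Pi.lt_def.2 ⟨hle S, i, ?_⟩
  simp [ind, hi, hi']

theorem twist_of_even (k : Type*) [CommRing k] {e : Fin n → ℕ} (he : ∀ i, Even (e i))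
    (b : Fin n → ℕ) : twist k e b = 1 := by
  refine Finset.prod_eq_one fun i _ => ?_
  obtain ⟨s, hs⟩ := (he i).two_dvd
  rw [hs, pow_mul, pow_two, sgn_mul_self, one_pow]

end Indicator

namespace IsSkewPBW

variable {k B : Type*} [CommRing k] [Ring B] [Algebra k B] {n : ℕ} {x : Fin n → B}
  {P : Module.Basis (Fin n → ℕ) k B}

theorem lead_prod (h : IsSkewPBW x P) {S ι : Type*} [CommRing S] (φ : S →+* B) (s : Finset ι)
    {f : ι → S} {b : ι → Fin n → ℕ} {c : ι → k} (hb : ∀ i j, Even (b i j))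
    (hf : ∀ i, Lead (P.repr (φ (f i))) (b i) (c i)) :
    Lead (P.repr (φ (∏ i ∈ s, f i))) (∑ i ∈ s, b i) (∏ i ∈ s, c i) := by
  classical
  induction s using Finset.induction_on with
  | empty =>
    simp only [Finset.prod_empty, Finset.sum_empty, map_one]
    rw [← monom_zero x, h.repr_monom]
    exact Lead.single 0 1
  | insert i s hi ih =>
    rw [Finset.prod_insert hi, Finset.sum_insert hi, Finset.prod_insert hi, map_mul]
    have := h.lead_mul (hf i) ih
    rwa [twist_of_even k (hb i), one_mul] at this

/-- For `σ ≠ 1` the Leibniz term is bounded by a strictly smaller exponent, so only the diagonal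
product contributes to the leading coefficient. -/
theorem lead_det (h : IsSkewPBW x P) {S : Type*} [CommRing S] (φ : S →+* B)
    (M : Matrix (Finset (Fin n)) (Finset (Fin n)) S) {γ : Finset (Fin n) → Finset (Fin n) → k}
    (hM : ∀ U V, Lead (P.repr (φ (M U V))) (ind 2 (U ∩ V)) (γ U V)) :
    Lead (P.repr (φ M.det)) (fun _ => 2 * 2 ^ (n - 1)) (∏ U, γ U U) := by
  rw [Matrix.det_apply, map_sum, map_sum, ← sum_ind]
  have key : ∀ σ : Equiv.Perm (Finset (Fin n)),
      Lead (P.repr (φ (Equiv.Perm.sign σ • ∏ U, M (σ U) U))) (∑ U : Finset (Fin n), ind 2 U)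
        (if σ = 1 then ∏ U, γ U U else 0) := by
    intro σ
    have hp := h.lead_prod φ Finset.univ (f := fun U => M (σ U) U)
      (b := fun U => ind 2 (σ U ∩ U)) (fun U => even_ind_two _) fun U => hM (σ U) U
    split_ifs with hσ
    · subst hσ
      simpa using hp
    · have h0 := hp.of_lt (sum_ind_inter_lt hσ)
      rcases Int.units_eq_one_or (Equiv.Perm.sign σ) with hs | hs
      · rwa [hs, one_smul]
      · rw [hs, Units.neg_smul, one_smul, map_neg, map_neg]
        simpa using h0.smul (-1)
  simpa using Lead.sum Finset.univ fun σ _ => key σ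

variable {R : Subalgebra k B}

theorem repr_mul_monom_ind (h : IsSkewPBW x P)
    (hmem : ∀ f, f ∈ R ↔ ∀ e, P.repr f e ≠ 0 → ∀ i, Even (e i)) {r : B} (hr : r ∈ R)
    (U : Finset (Fin n)) :
    P.repr (r * monom x (ind 1 U)) = (P.repr r).mapDomain (· + ind 1 U) := by
  rw [Finsupp.mapDomain, Finsupp.sum]
  conv_lhs => rw [h.eq_sum r]
  rw [Finset.sum_mul, map_sum]
  refine Finset.sum_congr rfl fun e he => ?_
  rw [smul_mul_assoc, ← monom_add_of_even h.commute_sq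
    ((hmem r).1 hr e (Finsupp.mem_support_iff.1 he)), map_smul, h.repr_monom]
  simp

/-- The exponents of `r` and `s` are even, so the parity of `s + ind 1 V` recovers `V` and separates
the multiples of different squarefree monomials. -/
theorem repr_mul_monom_ind_apply (h : IsSkewPBW x P)
    (hmem : ∀ f, f ∈ R ↔ ∀ e, P.repr f e ≠ 0 → ∀ i, Even (e i)) {r : B} (hr : r ∈ R)
    {s : Fin n → ℕ} (hs : ∀ i, Even (s i)) (U V : Finset (Fin n)) :
    P.repr (r * monom x (ind 1 U)) (s + ind 1 V) = if U = V then P.repr r s else 0 := by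
  classical
  rw [h.repr_mul_monom_ind hmem hr]
  split_ifs with hUV
  · subst hUV
    exact Finsupp.mapDomain_apply (add_left_injective _) _ _
  · by_contra hne
    obtain ⟨e, he, hes⟩ := Finset.mem_image.1
      (Finsupp.mapDomain_support (Finsupp.mem_support_iff.2 hne))
    have he' := (hmem r).1 hr e (Finsupp.mem_support_iff.1 he)
    refine hUV (Finset.ext fun i => ?_)
    have h1 := congrFun hes i
    have h2 := Nat.even_iff.1 (he' i)
    have h3 := Nat.even_iff.1 (hs i)
    simp only [Pi.add_apply, ind] at h1
    split_ifs at h1 with h4 h5 h5 <;> first | omega | simp [h4, h5]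

/-- The squarefree monomials are a basis over the subalgebra of the squares. -/
theorem exists_basis_ind (h : IsSkewPBW x P)
    (hmem : ∀ f, f ∈ R ↔ ∀ e, P.repr f e ≠ 0 → ∀ i, Even (e i)) :
    ∃ z : Module.Basis (Finset (Fin n)) R B, ∀ U, z U = monom x (ind 1 U) := by
  have hli : LinearIndependent R fun U : Finset (Fin n) => monom x (ind 1 U) := by
    rw [Fintype.linearIndependent_iff]
    intro r hr V
    refine Subtype.ext (P.repr.injective (Finsupp.ext fun s => ?_))
    rw [ZeroMemClass.coe_zero, map_zero, Finsupp.zero_apply]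
    by_contra hne
    have hs := (hmem (r V)).1 (r V).2 s hne
    have h0 := congrArg (fun f => P.repr f (s + ind 1 V)) hr
    simp only [map_sum, Finsupp.finsetSum_apply, Subalgebra.smul_def, smul_eq_mul, map_zero,
      Finsupp.zero_apply, h.repr_mul_monom_ind_apply hmem (r _).2 hs, Finset.sum_ite_eq',
      Finset.mem_univ, if_true] at h0
    exact hne h0
  refine ⟨Module.Basis.mk hli fun f _ => ?_, fun U => Module.Basis.mk_apply _ _ U⟩
  rw [h.eq_sum f]
  refine sum_mem fun e _ => Submodule.smul_of_tower_mem _ _ ?_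
  -- The odd positions of `e` form the squarefree part; the rest of the exponent is even and gives
  -- the coefficient in `R`.
  let U : Finset (Fin n) := Finset.univ.filter fun i => e i % 2 = 1
  have he : e = (fun i => 2 * (e i / 2)) + ind 1 U := by
    funext i
    simp only [Pi.add_apply, ind, U, Finset.mem_filter, Finset.mem_univ, true_and]
    split_ifs <;> omega
  have hev : ∀ i, Even ((fun i => 2 * (e i / 2)) i) := fun i => even_two_mul _
  have hR : monom x (fun i => 2 * (e i / 2)) ∈ R := by
    rw [hmem, h.repr_monom]
    intro e' he'
    rw [Finsupp.single_apply_ne_zero] at he'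
    rw [he'.1]
    exact hev
  rw [he, monom_add_of_even h.commute_sq hev]
  exact Submodule.smul_mem _ (⟨_, hR⟩ : R) (Submodule.subset_span ⟨U, rfl⟩)

theorem repr_coord (h : IsSkewPBW x P)
    (hmem : ∀ f, f ∈ R ↔ ∀ e, P.repr f e ≠ 0 → ∀ i, Even (e i))
    {z : Module.Basis (Finset (Fin n)) R B} (hz : ∀ U, z U = monom x (ind 1 U)) (f : B)
    {s : Fin n → ℕ} (hs : ∀ i, Even (s i)) (U : Finset (Fin n)) :
    P.repr (z.repr f U : B) s = P.repr f (s + ind 1 U) := by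
  conv_rhs => rw [← z.sum_repr f]
  simp only [map_sum, Finsupp.finsetSum_apply, Subalgebra.smul_def, smul_eq_mul, hz,
    h.repr_mul_monom_ind_apply hmem (z.repr f _).2 hs, Finset.sum_ite_eq', Finset.mem_univ,
    if_true]

theorem repr_regularTrace (h : IsSkewPBW x P) (hR : R ≤ Subalgebra.center k B)
    (hmem : ∀ f, f ∈ R ↔ ∀ e, P.repr f e ≠ 0 → ∀ i, Even (e i)) (f : B)
    {s : Fin n → ℕ} (hs : ∀ i, Even (s i)) :
    P.repr (regularTrace R hR f : B) s =
      ∑ U, P.repr (f * monom x (ind 1 U)) (s + ind 1 U) := by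
  obtain ⟨z, hz⟩ := h.exists_basis_ind hmem
  rw [regularTrace_eq_sum hR z, AddSubmonoidClass.coe_finsetSum, map_sum,
    Finsupp.finsetSum_apply]
  exact Finset.sum_congr rfl fun U _ => by rw [h.repr_coord hmem hz _ hs, hz]

theorem le_of_repr_regularTrace_ne_zero (h : IsSkewPBW x P) (hR : R ≤ Subalgebra.center k B)
    (hmem : ∀ f, f ∈ R ↔ ∀ e, P.repr f e ≠ 0 → ∀ i, Even (e i)) {f : B} {m : Fin n → ℕ} {β : k}
    (hf : Lead (P.repr f) m β) {e : Fin n → ℕ} (he : P.repr (regularTrace R hR f : B) e ≠ 0) :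
    (∀ i, Even (e i)) ∧ e ≤ m := by
  have hev := (hmem _).1 (regularTrace R hR f).2 e he
  refine ⟨hev, ?_⟩
  rw [h.repr_regularTrace hR hmem f hev] at he
  obtain ⟨U, -, hU⟩ := Finset.exists_ne_zero_of_sum_ne_zero he
  have hl := h.lead_mul hf (c := ind 1 U) (γ := 1) (g := monom x (ind 1 U))
    (by rw [h.repr_monom]; exact Lead.single _ _)
  exact le_of_add_le_add_right (hl.le _ hU)

/-- An even monomial multiplies each of the `2ⁿ` basis elements with trivial sign, so each
contributes `β` to the trace. -/
theorem lead_regularTrace (h : IsSkewPBW x P) (hR : R ≤ Subalgebra.center k B)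
    (hmem : ∀ f, f ∈ R ↔ ∀ e, P.repr f e ≠ 0 → ∀ i, Even (e i)) {f : B} {m : Fin n → ℕ} {β : k}
    (hf : Lead (P.repr f) m β) (hm : ∀ i, Even (m i)) :
    Lead (P.repr (regularTrace R hR f : B)) m (2 ^ n * β) := by
  refine ⟨?_, fun e he => (h.le_of_repr_regularTrace_ne_zero hR hmem hf he).2⟩
  rw [h.repr_regularTrace hR hmem f hm, Finset.sum_congr rfl fun U _ => (h.lead_mul hf
    (c := ind 1 U) (γ := 1) (g := monom x (ind 1 U))
    (by rw [h.repr_monom]; exact Lead.single _ _)).coeff]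
  simp [twist_of_even k hm]

theorem lead_regularTrace_mul (h : IsSkewPBW x P) (hR : R ≤ Subalgebra.center k B)
    (hmem : ∀ f, f ∈ R ↔ ∀ e, P.repr f e ≠ 0 → ∀ i, Even (e i)) (U V : Finset (Fin n)) :
    ∃ γ : k, Lead (P.repr (regularTrace R hR (monom x (ind 1 U) * monom x (ind 1 V)) : B))
      (ind 2 (U ∩ V)) γ ∧ (U = V → γ = 2 ^ n * twist k (ind 1 U) (ind 1 U)) := by
  have hl := h.lead_monom_mul (ind 1 U) (ind 1 V)
  by_cases hUV : U = V
  · subst hUV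
    refine ⟨_, ?_, fun _ => rfl⟩
    have he : ind 1 U + ind 1 U = ind 2 (U ∩ U) := by
      funext i
      simp only [Pi.add_apply, ind, Finset.inter_self]
      split_ifs <;> rfl
    rw [he] at hl
    exact h.lead_regularTrace hR hmem hl (even_ind_two _)
  · refine ⟨_, ⟨rfl, fun e he i => ?_⟩, fun h' => absurd h' hUV⟩
    -- The bound `1_U + 1_V` equals 1 on the symmetric difference, where evenness forces exponent 0;
    -- only twice the indicator of `U ∩ V` remains.
    obtain ⟨h1, h2⟩ := h.le_of_repr_regularTrace_ne_zero hR hmem hl he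
    have h3 := Nat.even_iff.1 (h1 i)
    have h4 := h2 i
    simp only [Pi.add_apply, ind, Finset.mem_inter] at h4 ⊢
    split_ifs at h4 ⊢ <;> simp_all <;> omega

/-- Degrees add because `gr B` is a domain, so a unit has degree 0 and lies in `F₀ = k`. -/
theorem exists_eq_algebraMap_of_mul_eq_one [IsDomain k] (h : IsSkewPBW x P) {f g : B}
    (hfg : f * g = 1) : ∃ c : k, f = algebraMap k B c := by
  have := h.nontrivial
  have hF := h.isFilteredDomain.isConnectedDomain
  have := hF.isDomain
  have hf : f ≠ 0 := left_ne_zero_of_mul_eq_one hfg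
  have hg : g ≠ 0 := right_ne_zero_of_mul_eq_one hfg
  have hnot := AlgFiltration.mul_notMem_prev _ (hF.exhaustive.mem_piece_deg f)
    (AlgFiltration.notMem_prev_deg hf) (hF.exhaustive.mem_piece_deg g)
    (AlgFiltration.notMem_prev_deg hg)
  rw [hfg] at hnot
  have h0 : (stdFiltration k x).deg f = 0 := by
    by_contra hne
    exact hnot (AlgFiltration.piece_le_prev _ (by omega) (stdFiltration k x).one_mem)
  have hmem := hF.exhaustive.mem_piece_deg f
  rw [h0, hF.connected.2] at hmem
  obtain ⟨c, hc⟩ := Submodule.mem_one.1 hmem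
  exact ⟨c, hc.symm⟩

theorem exists_basis_fin (h : IsSkewPBW x P)
    (hmem : ∀ f, f ∈ R ↔ ∀ e, P.repr f e ≠ 0 → ∀ i, Even (e i)) :
    ∃ (z : Module.Basis (Fin (2 ^ n)) R B) (ε : Finset (Fin n) ≃ Fin (2 ^ n)),
      ∀ U, z (ε U) = monom x (ind 1 U) := by
  obtain ⟨z, hz⟩ := h.exists_basis_ind hmem
  let ε : Finset (Fin n) ≃ Fin (2 ^ n) := Fintype.equivFinOfCardEq (by simp)
  exact ⟨z.reindex ε, ε, fun U => by rw [z.reindex_apply, ε.symm_apply_apply, hz]⟩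

/-- The discriminant over the subalgebra of the squares is `c (∏ xᵢ²) ^ (2 ^ (n - 1)) + (cwlt)`. -/
theorem lead_disc [IsDomain k] (h2 : IsUnit (2 : k)) (h : IsSkewPBW x P)
    (hR : R ≤ Subalgebra.center k B)
    (hmem : ∀ f, f ∈ R ↔ ∀ e, P.repr f e ≠ 0 → ∀ i, Even (e i))
    (Z : Module.Basis (Fin (2 ^ n)) R B) :
    ∃ c : kˣ, Lead (P.repr (disc R hR Z : B)) (fun _ => 2 * 2 ^ (n - 1)) c := by
  obtain ⟨z, ε, hz⟩ := h.exists_basis_fin hmem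
  choose γ hγ hγ' using h.lead_regularTrace_mul hR hmem
  have hz' : Lead (P.repr (disc R hR z : B)) (fun _ => 2 * 2 ^ (n - 1)) (∏ U, γ U U) := by
    let := centralCommRing R hR
    have := h.lead_det (S := R) R.val.toRingHom ((Matrix.of fun i j : Fin (2 ^ n) =>
      regularTrace R hR (z i * z j)).submatrix ε ε) (γ := γ) fun U V => ?_
    · rw [Matrix.det_submatrix_equiv_self] at this
      exact this
    · rw [Matrix.submatrix_apply, Matrix.of_apply, hz, hz]
      exact hγ U V
  obtain ⟨u, v, huv, hu⟩ := exists_disc_eq_unit_mul hR z Z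
  have huv' : (u : B) * v = 1 := congrArg Subtype.val huv
  have hvu' : (v : B) * u = 1 := by
    rw [Subalgebra.mem_center_iff.1 (hR u.2) v]; exact huv'
  obtain ⟨c, hc⟩ := h.exists_eq_algebraMap_of_mul_eq_one huv'
  obtain ⟨d, hd⟩ := h.exists_eq_algebraMap_of_mul_eq_one hvu'
  have hcd : c * d = 1 := by
    apply h.algebraMap_injective
    rw [map_mul, ← hc, ← hd, huv', map_one]
  have hunit : IsUnit (c * c * ∏ U, γ U U) := by
    have hcu : IsUnit c := IsUnit.of_mul_eq_one d hcd
    refine (hcu.mul hcu).mul ?_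
    refine Finset.prod_induction _ IsUnit (fun _ _ => IsUnit.mul) isUnit_one fun U _ => ?_
    rw [hγ' U U rfl]
    exact (h2.pow n).mul (IsUnit.of_mul_eq_one _ (twist_mul_self k _ _))
  refine ⟨hunit.unit, ?_⟩
  have hd' : (disc R hR Z : B) = (c * c) • (disc R hR z : B) := by
    rw [hu, Algebra.smul_def, map_mul, ← hc]
    rfl
  rw [hd', map_smul]
  exact hz'.smul (c * c)

end IsSkewPBW

/-! ### Domination, affine automorphisms and the category `Af` -/

namespace IsSkewPBW

variable {k : Type u} {B : Type w} [CommRing k] [Ring B] [Algebra k B] {n : ℕ} {x : Fin n → B}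
  {P : Module.Basis (Fin n → ℕ) k B} {R : Subalgebra k B}

theorem disc_sub_mem_cwlt [IsDomain k] (h2 : IsUnit (2 : k)) (h : IsSkewPBW x P)
    (hR : R ≤ Subalgebra.center k B)
    (hmem : ∀ f, f ∈ R ↔ ∀ e, P.repr f e ≠ 0 → ∀ i, Even (e i))
    (Z : Module.Basis (Fin (2 ^ n)) R B) :
    ∃ c : kˣ, (disc R hR Z : B) - (c : k) • monom x (fun _ => 2) ^ 2 ^ (n - 1) ∈
      cwlt k x fun _ => 2 * 2 ^ (n - 1) := by
  obtain ⟨c, hc⟩ := h.lead_disc h2 hR hmem Z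
  refine ⟨c, ?_⟩
  rw [monom_pow_of_even h.commute_sq fun _ => even_two]
  have hb : (2 ^ (n - 1) • fun _ => 2 : Fin n → ℕ) = fun _ => 2 * 2 ^ (n - 1) := by
    funext i
    simp [mul_comm]
  rw [hb]
  exact h.lead_iff.1 hc

theorem isDominating_disc [IsDomain k] (h2 : IsUnit (2 : k)) (h : IsSkewPBW x P)
    (hR : R ≤ Subalgebra.center k B)
    (hmem : ∀ f, f ∈ R ↔ ∀ e, P.repr f e ≠ 0 → ∀ i, Even (e i))
    (Z : Module.Basis (Fin (2 ^ n)) R B) :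
    IsDominating.{u, v, w} (k := k) x (disc R hR Z : B) := by
  have := h.nontrivial
  obtain ⟨c, hc⟩ := h.disc_sub_mem_cwlt h2 hR hmem Z
  refine isDominating_of_sub_mem_cwlt h.isFilteredDomain (fun h0 => ?_) c.ne_zero
    (Nat.two_pow_pos (n - 1)) hc
  obtain ⟨c', hc'⟩ := h.lead_disc h2 hR hmem Z
  rw [h0, map_zero] at hc'
  exact c'.ne_zero hc'.coeff.symm

theorem hasDominatingDisc [IsDomain k] (h2 : IsUnit (2 : k)) (h : IsSkewPBW x P)
    (hR : R ≤ Subalgebra.center k B)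
    (hmem : ∀ f, f ∈ R ↔ ∀ e, P.repr f e ≠ 0 → ∀ i, Even (e i))
    (hrank : Module.finrank R B = 2 ^ n) :
    HasDominatingDisc.{u, v, w} x R hR := by
  obtain ⟨Z, -⟩ := h.exists_basis_fin hmem
  refine ⟨disc R hR Z, ?_, h.isDominating_disc h2 hR hmem Z⟩
  rw [hrank]
  exact discIdeal_eq_span hR Z

theorem finite_free_finrank [IsDomain k] (h : IsSkewPBW x P) (hR : R ≤ Subalgebra.center k B)
    (hmem : ∀ f, f ∈ R ↔ ∀ e, P.repr f e ≠ 0 → ∀ i, Even (e i)) :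
    Module.Finite R B ∧ Module.Free R B ∧ Module.finrank R B = 2 ^ n := by
  have := h.nontrivial
  obtain ⟨Z, -⟩ := h.exists_basis_fin hmem
  refine ⟨Module.Finite.of_basis Z, Module.Free.of_basis Z, ?_⟩
  let := centralCommRing R hR
  have := Module.finrank_eq_card_basis Z
  rwa [Fintype.card_fin] at this

theorem isAffine [IsDomain k] (h2 : IsUnit (2 : k)) (h : IsSkewPBW x P)
    (hR : R ≤ Subalgebra.center k B)
    (hmem : ∀ f, f ∈ R ↔ ∀ e, P.repr f e ≠ 0 → ∀ i, Even (e i)) (g : B ≃ₐ[k] B)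
    (h1 : ∀ r ∈ R, g r ∈ R) (h1' : ∀ r ∈ R, g.symm r ∈ R) : IsAffine x g := by
  have := h.nontrivial
  have hF := h.isFilteredDomain.isConnectedDomain
  obtain ⟨Z, -⟩ := h.exists_basis_fin hmem
  obtain ⟨Z', hZ'⟩ := exists_basis_map Z g h1 h1'
  have hmap : (disc R hR Z' : B) = g (disc R hR Z) := by
    rw [funext hZ']
    exact disc_map hR Z g h1 h1' Z
  obtain ⟨c, hc⟩ := h.disc_sub_mem_cwlt h2 hR hmem Z
  obtain ⟨c', hc'⟩ := h.disc_sub_mem_cwlt h2 hR hmem Z'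
  -- The transported family is again a basis, so its discriminant obeys the degree bound that holds
  -- for every basis.
  have hle := deg_stdFiltration_le x (c' : k) _ hc'
  rw [add_sub_cancel, hmap] at hle
  have hv := Submodule.mem_map_of_mem (f := (g : B →ₐ[k] B).toLinearMap) hc
  rw [map_cwlt] at hv
  have hy0 : ∀ i, g (x i) ∉ (stdFiltration k x).piece 0 := by
    intro i hi
    rw [hF.connected.2] at hi
    obtain ⟨r, hr⟩ := Submodule.mem_one.1 hi
    have hx : algebraMap k B r = x i := g.injective (by rw [AlgEquiv.commutes, hr])
    have := congrArg P.repr hx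
    rw [h.repr_algebraMap, h.repr_gen] at this
    have := congrArg (fun v => v (Pi.single i 1)) this
    simp only [Finsupp.single_eq_same] at this
    rw [Finsupp.single_apply, if_neg] at this
    · exact zero_ne_one this
    · intro h0
      simpa using congrFun h0 i
  -- The exact degree formula is applied inside `B` itself, with `yᵢ = g (x i)`; these are not
  -- scalars because `g` fixes `k`.
  have hdeg := deg_smul_monom_add_cwlt hF hy0 c.ne_zero _ hv
  have hg : (c : k) • monom (fun i => g (x i)) (fun _ => 2) ^ 2 ^ (n - 1) +
      (g : B →ₐ[k] B).toLinearMap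
        ((disc R hR Z : B) - (c : k) • monom x (fun _ => 2) ^ 2 ^ (n - 1)) =
      g (disc R hR Z) := by
    have := map_monom (g : B →ₐ[k] B) x fun _ => 2
    simp only [AlgHom.toLinearMap_apply, map_sub, map_smul, map_pow, this]
    simp
  have hdeg' : (stdFiltration k x).deg (g (disc R hR Z)) =
      ∑ i, 2 * 2 ^ (n - 1) * (stdFiltration k x).deg (g (x i)) := by
    rw [← hg]; exact hdeg
  rw [hdeg'] at hle
  have hpos : ∀ i, 1 ≤ (stdFiltration k x).deg (g (x i)) := fun i => by
    by_contra! hlt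
    exact hy0 i ((stdFiltration k x).mono (by omega) (hF.exhaustive.mem_piece_deg (g (x i))))
  have hN : 0 < 2 * 2 ^ (n - 1) := by positivity
  intro i
  refine le_antisymm ?_ (hpos i)
  by_contra! hlt
  refine absurd hle (not_le.2 (Finset.sum_lt_sum
    (fun i _ => Nat.le_mul_of_pos_right _ (hpos i)) ⟨i, Finset.mem_univ i, ?_⟩))
  exact (Nat.lt_mul_iff_one_lt_right hN).2 hlt

theorem inAf [IsDomain k] (h2 : IsUnit (2 : k)) (hn : Even n) (h : IsSkewPBW x P) :
    InAf.{u, v, w} k x := by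
  have hmem : ∀ f, f ∈ Subalgebra.center k B ↔ ∀ e, P.repr f e ≠ 0 → ∀ i, Even (e i) := by
    intro f
    rw [h.center_eq h2.ne_zero hn]
    exact h.mem_adjoin_sq_iff
  obtain ⟨hfin, hfree, hrank⟩ := h.finite_free_finrank le_rfl hmem
  have : Module.Free k B := Module.Free.of_basis P
  exact ⟨inferInstance, h.isFilteredDomain, hfin, hfree,
    h.hasDominatingDisc h2 le_rfl hmem hrank⟩

end IsSkewPBW

end DiscAut

end

theorem theorem4p9 (k : Type u) [CommRing k] [IsDomain k] (h2 : IsUnit (2 : k))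
    (n : ℕ) (hn : 0 < n) (a : Fin n → Fin n → k) :
    -- (1) the algebra is finitely generated free of rank `2 ^ n` over `R`; its discriminant (with
    -- respect to any basis) is `c (∏ xᵢ²) ^ (2 ^ (n - 1)) + cwlt`, and it is dominating
    ((Module.Finite (DiscAut.sqSubalgebra a) (DiscAut.QWeyl a) ∧
        Module.Free (DiscAut.sqSubalgebra a) (DiscAut.QWeyl a) ∧
        Module.finrank (DiscAut.sqSubalgebra a) (DiscAut.QWeyl a) = 2 ^ n) ∧
      (∀ Z : Module.Basis (Fin (2 ^ n)) (DiscAut.sqSubalgebra a) (DiscAut.QWeyl a),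
        (∃ c : kˣ,
          (DiscAut.disc (DiscAut.sqSubalgebra a) (DiscAut.sqSubalgebra_le_center a) Z :
              DiscAut.QWeyl a)
            - (c : k) • DiscAut.monom (DiscAut.qx a) (fun _ => 2) ^ 2 ^ (n - 1)
            ∈ DiscAut.cwlt k (DiscAut.qx a) (fun _ => 2 * 2 ^ (n - 1))) ∧
        DiscAut.IsDominating.{u, v, u} (k := k) (DiscAut.qx a)
          (DiscAut.disc (DiscAut.sqSubalgebra a) (DiscAut.sqSubalgebra_le_center a) Z :
            DiscAut.QWeyl a)) ∧
      DiscAut.HasDominatingDisc.{u, v, u} (DiscAut.qx a) (DiscAut.sqSubalgebra a)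
        (DiscAut.sqSubalgebra_le_center a)) ∧
    -- (2) automorphisms that, together with their inverses, preserve `R` are affine
    (∀ g : DiscAut.QWeyl a ≃ₐ[k] DiscAut.QWeyl a,
      (∀ r ∈ DiscAut.sqSubalgebra a, g r ∈ DiscAut.sqSubalgebra a) →
      (∀ r ∈ DiscAut.sqSubalgebra a, g.symm r ∈ DiscAut.sqSubalgebra a) →
      DiscAut.IsAffine (DiscAut.qx a) g) ∧
    -- (3) for even `n` the algebra is in `Af`
    (Even n → DiscAut.InAf.{u, v, u} k (DiscAut.qx a)) := by
  have h := DiscAut.isSkewPBW_pbw a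
  have hR := DiscAut.sqSubalgebra_le_center a
  have hmem : ∀ f, f ∈ DiscAut.sqSubalgebra a ↔
      ∀ e, (DiscAut.pbw a).repr f e ≠ 0 → ∀ i, Even (e i) := fun f => h.mem_adjoin_sq_iff
  have hfree := h.finite_free_finrank hR hmem
  exact ⟨⟨hfree, fun Z => ⟨h.disc_sub_mem_cwlt h2 hR hmem Z, h.isDominating_disc h2 hR hmem Z⟩,
      h.hasDominatingDisc h2 hR hmem hfree.2.2⟩,
    fun g h1 h1' => h.isAffine h2 hR hmem g h1 h1', fun he => h.inAf h2 he⟩
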